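/- Let $G=(V,E)$ be a quantum network, i.e. a finite hypergraph whose vertices are the nodes (parties) and whose hyperedges are the sources; two distinct nodes are adjacent if some hyperedge contains both, and $G$ is incomplete if some two distinct nodes are not adjacent. The connected domination number $d_c(G)$ is the minimal size of a nonempty set $S\subseteq V$ such that the subnetwork induced by $S$ is connected and every node lies in $S$ or is adjacent to a node of $S$ (it is $\infty$ if there is no such $S$, i.e. if $G$ is disconnected). A $G$ state is a state $\bigotimes_{e\in E}\gamma_e$, where each source $e$ emits an arbitrary state $\gamma_e$ of particles (of arbitrary finite dimensions), one for each node in $e$, and each node holds all particles that it receives. In a round of an LOCC protocol, one node (which may depend on the earlier messages) applies a local quantum instrument and broadcasts its outcome to all other nodes, which then apply local channels that may depend on this outcome; a protocol with $k$ rounds consists of $k$ consecutive rounds followed by local channels, and shared randomness is free (so that a protocol with $0$ rounds consists of local operations and shared randomness). For a state $\sigma$ of finite-dimensional systems held by the nodes, let $r_r(\sigma|G)\in\mathbb{N}\cup\{\infty\}$ be the minimal $k$ such that $\sigma$ lies in the closure of the set of states that can be prepared from $G$ states by $k$-round LOCC protocols. The network round complexity of a state $\rho$ is $$\mathcal{E}_r(\rho|G)=\inf\Big\{\sum_i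 p_i\, r_r(\rho_i|G)\;:\;\rho=\sum_i p_i\rho_i\Big\},$$ where the infimum is over all finite convex decompositions of $\rho$ into states (with $0\cdot\infty=0$). Theorem. Let $G$ be an incomplete network and let $\rho$ be a pure state, with one finite-dimensional system at each node, such that for every pair of distinct non-adjacent nodes $u,v$ the bipartite reduced state $\rho_{uv}$ is entangled (i.e. not a convex combination of product states). Then $$\mathcal{E}_r(\rho|G)=d_c(G).$$ -/

import Mathlib

open scoped NNReal ENNReal Matrix Kronecker ComplexOrder

noncomputable section

namespace QNet

/-! ### Networks and their graph parameters -/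

/-- A quantum network: a finite hypergraph whose nodes are the elements of `V`. Each hyperedge is a
source that distributes particles to the nodes it contains. -/
structure Network (V : Type*) where
  /-- the hyperedges (sources) -/
  edges : Finset (Finset V)

/-- The adjacency graph of a network: two distinct nodes are adjacent if they share a source. -/
def Network.graph {V : Type*} (G : Network V) : SimpleGraph V where
  Adj u v := u ≠ v ∧ ∃ e ∈ G.edges, u ∈ e ∧ v ∈ e
  symm := ⟨fun _ _ h => ⟨h.1.symm, h.2.imp fun _ he => ⟨he.1, he.2.2, he.2.1⟩⟩⟩
  loopless := ⟨fun _ h => h.1 rfl⟩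

/-- A network is complete if any two distinct nodes share a source. -/
def Network.IsComplete {V : Type*} (G : Network V) : Prop :=
  ∀ u v : V, u ≠ v → G.graph.Adj u v

/-- `S` induces a (nonempty) connected subnetwork, and every node is in `S` or adjacent to a node
in `S`. -/
def Network.IsConnectedDominating {V : Type*} (G : Network V) (S : Finset V) : Prop :=
  (G.graph.induce (S : Set V)).Connected ∧ ∀ v : V, v ∈ S ∨ ∃ s ∈ S, G.graph.Adj s v

/-- The connected domination number `d_c(G)`; it is finite exactly when a connected dominating set
exists. -/
def Network.connectedDominationNumber {V : Type*} (G : Network V) : ℕ∞ :=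
  ⨅ (S : Finset V) (_ : G.IsConnectedDominating S), (S.card : ℕ∞)

/-! ### States -/

/-- Density matrices. -/
def IsState {ι : Type*} [Fintype ι] (ρ : Matrix ι ι ℂ) : Prop :=
  ρ.PosSemidef ∧ ρ.trace = 1

/-- Pure states `|ψ⟩⟨ψ|` with `ψ` a unit vector. -/
def IsPureState {ι : Type*} [Fintype ι] (ρ : Matrix ι ι ℂ) : Prop :=
  ∃ ψ : ι → ℂ, star ψ ⬝ᵥ ψ = 1 ∧ ρ = Matrix.vecMulVec ψ (star ψ)

/-- Separable bipartite states: convex combinations of product states. -/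
def IsSeparable {ι κ : Type*} [Fintype ι] [Fintype κ] (τ : Matrix (ι × κ) (ι × κ) ℂ) : Prop :=
  τ ∈ convexHull ℝ
    {M | ∃ (σ : Matrix ι ι ℂ) (ω : Matrix κ κ ℂ), IsState σ ∧ IsState ω ∧ M = σ ⊗ₖ ω}

section Multipartite

variable {V : Type*} [Fintype V] [DecidableEq V]

/-- Labels of the computational basis of `⨂_v ℂ^{d v}`. -/
abbrev Idx (d : V → ℕ) : Type _ := (v : V) → Fin (d v)

/-- Operators on `⨂_v ℂ^{d v}`, written in the computational basis. -/
abbrev Op (d : V → ℕ) : Type _ := Matrix (Idx d) (Idx d) ℂ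

/-- The reduced operator on the nodes `i` and `j` (for `i ≠ j`): the other nodes are traced out. -/
def reducedPair {d : V → ℕ} (ρ : Op d) (i j : V) :
    Matrix (Fin (d i) × Fin (d j)) (Fin (d i) × Fin (d j)) ℂ :=
  Matrix.of fun a b => ∑ x : Idx d,
    if x i = a.1 ∧ x j = a.2 then
      ρ x (Function.update (Function.update x i b.1) j b.2)
    else 0

/-! ### States distributed by the sources of a network -/

/-- The hyperedges of `G` that contain the node `v`. -/
abbrev Network.Incident (G : Network V) (v : V) : Type _ := {e : Finset V // e ∈ G.edges ∧ v ∈ e}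

/-- `τ` is a `G` state `⨂_{e ∈ E} γ_e`: the source `e` emits the state `γ e` on `⨂_{v ∈ e} ℂ^{D e v}`
(of arbitrary finite dimension), and the system at the node `v`, of dimension `n v`, is the tensor
product `⨂_{e ∋ v} ℂ^{D e v}` of the particles which `v` receives; `φ v` identifies the basis labels
of the two. -/
def IsNetworkState (G : Network V) {n : V → ℕ} (τ : Op n) : Prop :=
  ∃ (D : Finset V → V → ℕ)
    (φ : (v : V) → (Fin (n v) ≃ ((e : G.Incident v) → Fin (D e.1 v))))
    (γ : (e : Finset V) →
      Matrix ((v : {v // v ∈ e}) → Fin (D e v.1)) ((v : {v // v ∈ e}) → Fin (D e v.1)) ℂ),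
    (∀ e ∈ G.edges, IsState (γ e)) ∧
    ∀ x y : Idx n, τ x y = ∏ e : {e // e ∈ G.edges},
      γ e.1 (fun v => φ v.1 (x v.1) ⟨e.1, e.2, v.2⟩) (fun v => φ v.1 (y v.1) ⟨e.1, e.2, v.2⟩)

/-! ### Local operations and protocols -/

/-- A finite family of Kraus operators `ℂ^n → ℂ^m`; it describes the completely positive map
`X ↦ ∑_j K_j X K_jᴴ`. -/
structure Kraus (n m : ℕ) where
  /-- the number of Kraus operators -/
  rank : ℕ
  /-- the Kraus operators -/
  op : Fin rank → Matrix (Fin m) (Fin n) ℂ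

/-- `∑_j K_jᴴ K_j`. -/
def Kraus.gram {n m : ℕ} (K : Kraus n m) : Matrix (Fin n) (Fin n) ℂ :=
  ∑ j, (K.op j)ᴴ * K.op j

/-- A quantum channel: the completely positive map is trace preserving. -/
def Kraus.IsChannel {n m : ℕ} (K : Kraus n m) : Prop := K.gram = 1

/-- The tensor product `⨂_v A_v` of local operators. -/
def tensorOp {n m : V → ℕ} (A : (v : V) → Matrix (Fin (m v)) (Fin (n v)) ℂ) :
    Matrix (Idx m) (Idx n) ℂ :=
  Matrix.of fun y x => ∏ v, A v (y v) (x v)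

/-- The tensor product of the local completely positive maps with Kraus families `K v`. -/
def productMap {n m : V → ℕ} (K : (v : V) → Kraus (n v) (m v)) (τ : Op n) : Op m :=
  ∑ j : ((v : V) → Fin (K v).rank),
    tensorOp (fun v => (K v).op (j v)) * τ * (tensorOp (fun v => (K v).op (j v)))ᴴ

/-- `IsLOCC k n m Λ`: the map `Λ` is implemented by an LOCC protocol with `k` rounds of broadcast
communication, without shared randomness. With no rounds, all nodes apply local channels. In a
round, one node `v` applies a local instrument `(K i v)_i` and broadcasts the outcome `i`; the other
nodes `u` apply channels `K i u` that may depend on `i`; then the protocol goes on with `k` further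
rounds, which may depend on `i`. -/
inductive IsLOCC : ℕ → (n m : V → ℕ) → (Op n → Op m) → Prop
  | localOps {n m : V → ℕ} (K : (v : V) → Kraus (n v) (m v)) (hK : ∀ v, (K v).IsChannel) :
      IsLOCC 0 n m (productMap K)
  | round {k : ℕ} {n m : V → ℕ} (v : V) (N : ℕ) (l : Fin N → V → ℕ)
      (K : (i : Fin N) → (u : V) → Kraus (n u) (l i u))
      (hv : ∑ i, (K i v).gram = 1)
      (hu : ∀ i, ∀ u, u ≠ v → (K i u).IsChannel)
      (Λ : (i : Fin N) → Op (l i) → Op m)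
      (hΛ : ∀ i, IsLOCC k (l i) m (Λ i)) :
      IsLOCC (k + 1) n m (fun τ => ∑ i, Λ i (productMap (K i) τ))

/-- The operators on `⨂_v ℂ^{d v}` that can be prepared exactly from some `G` state by shared
randomness and LOCC with `k` rounds. For `k = 0` this is preparation by local operations and shared
randomness (LOSR). -/
def preparable (G : Network V) (d : V → ℕ) (k : ℕ) : Set (Op d) :=
  {ρ | ∃ (n : V → ℕ) (τ : Op n) (N : ℕ) (p : Fin N → ℝ≥0) (Λ : Fin N → Op n → Op d),
    IsNetworkState G τ ∧ ∑ t, p t = 1 ∧ (∀ t, IsLOCC k n d (Λ t)) ∧ ρ = ∑ t, p t • Λ t τ}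

/-- `r_r(ρ|G)`: the minimal number of rounds of an LOCC protocol which prepares `ρ` from `G` states
to arbitrary accuracy (`⊤` if there is none). -/
def minRounds (G : Network V) {d : V → ℕ} (ρ : Op d) : ℕ∞ :=
  ⨅ (k : ℕ) (_ : ρ ∈ closure (preparable G d k)), (k : ℕ∞)

/-- The network round complexity `E_r(ρ|G)`: the minimum of `∑ i, p i * r_r(σ i|G)` over all convex
decompositions `ρ = ∑ i, p i • σ i` into states. -/
def networkRoundComplexity (G : Network V) {d : V → ℕ} (ρ : Op d) : ℝ≥0∞ :=
  ⨅ (N : ℕ) (p : Fin N → ℝ≥0) (σ : Fin N → Op d)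
    (_ : ∑ i, p i = 1 ∧ (∀ i, IsState (σ i)) ∧ ρ = ∑ i, p i • σ i),
    ∑ i, (p i : ℝ≥0∞) * (minRounds G (σ i) : ℝ≥0∞)

end Multipartite

end QNet

end

noncomputable section

namespace QNet

-- For a pure state the convex roof is trivial: every state of positive weight in a decomposition of
-- $\rho$ equals $\rho$ (`networkRoundComplexity_of_isPureState`). It remains to show that the
-- minimal number of rounds is $d_c(G)$.
--
-- Lower bound. A $k$-round protocol is a sum of branches, each a product of local completely
-- positive maps that are trace preserving outside a set $S$ of at most $k$ nodes
-- (`IsLOCC.exists_branches`). If $S$ is not a connected dominating set, some non-adjacent $u \ne v$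
-- are not joined by a path inside $S \cup \{u,v\}$ (`isConnectedDominating_of_forall_reachable`;
-- incompleteness excludes $S = \emptyset$). Tracing out the other nodes discards their particles,
-- so the sources split into two groups and the branch has a product reduced state on $u, v$
-- (`exists_reducedPair_eq_kronecker`). Normalized branches thus lie in a compact set which misses
-- $\rho$, and their overlap with $\rho$ is at most some $c < 1$. The bound passes to sums and to
-- closures.
--
-- Upper bound. Enumerate a connected dominating set so that each node is adjacent to an earlier
-- one. The first node prepares $\rho$ locally; each node in turn teleports the systems not meant
-- for the nodes already reached, using one round for all of them (`Step.trans`, `step_teleport`).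
-- After one round per node, every system can be where it belongs (`covers_univ`), so $\rho$ is
-- prepared exactly.

universe u

/-! ### Branches of LOCC protocols -/

section Branches

variable {V : Type*} [Fintype V] [DecidableEq V]

theorem tensorOp_mul {n m l : V → ℕ} (B : (v : V) → Matrix (Fin (l v)) (Fin (m v)) ℂ)
    (A : (v : V) → Matrix (Fin (m v)) (Fin (n v)) ℂ) :
    tensorOp B * tensorOp A = tensorOp fun v => B v * A v := by
  ext x z
  simp only [tensorOp, Matrix.mul_apply, Matrix.of_apply, ← Finset.prod_mul_distrib]
  exact (Fintype.prod_sum fun v j => B v (x v) j * A v j (z v)).symm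

/-- The composition of two Kraus families. -/
def Kraus.comp {n m l : ℕ} (K' : Kraus m l) (K : Kraus n m) : Kraus n l where
  rank := K'.rank * K.rank
  op j := K'.op (finProdFinEquiv.symm j).1 * K.op (finProdFinEquiv.symm j).2

theorem Kraus.gram_comp {n m l : ℕ} (K' : Kraus m l) (K : Kraus n m) :
    (K'.comp K).gram = ∑ j, (K.op j)ᴴ * K'.gram * K.op j := by
  unfold Kraus.gram
  refine (Equiv.sum_comp (finProdFinEquiv (m := K'.rank) (n := K.rank)) _).symm.trans ?_
  rw [Fintype.sum_prod_type_right]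
  refine Finset.sum_congr rfl fun j _ => ?_
  rw [Matrix.mul_sum, Matrix.sum_mul]
  refine Finset.sum_congr rfl fun i _ => ?_
  simp only [Kraus.comp, Equiv.symm_apply_apply, Matrix.conjTranspose_mul, Matrix.mul_assoc]

theorem Kraus.IsChannel.gram_comp {n m l : ℕ} {K' : Kraus m l} (h : K'.IsChannel)
    (K : Kraus n m) : (K'.comp K).gram = K.gram := by
  rw [Kraus.gram_comp, h]
  simp [Kraus.gram]

theorem Kraus.IsChannel.comp {n m l : ℕ} {K' : Kraus m l} (h' : K'.IsChannel)
    {K : Kraus n m} (h : K.IsChannel) : (K'.comp K).IsChannel :=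
  (h'.gram_comp K).trans h

theorem productMap_comp {n m l : V → ℕ} (K' : (v : V) → Kraus (m v) (l v))
    (K : (v : V) → Kraus (n v) (m v)) (τ : Op n) :
    productMap K' (productMap K τ) = productMap (fun v => (K' v).comp (K v)) τ := by
  let e : (((v : V) → Fin (K' v).rank) × ((v : V) → Fin (K v).rank)) ≃
      ((v : V) → Fin ((K' v).comp (K v)).rank) :=
    { toFun := fun p v => finProdFinEquiv (p.1 v, p.2 v)
      invFun := fun j => (fun v => (finProdFinEquiv.symm (j v)).1,
        fun v => (finProdFinEquiv.symm (j v)).2)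
      left_inv := fun p => by simp
      right_inv := fun j => by
        funext v
        exact finProdFinEquiv.apply_symm_apply (j v) }
  unfold productMap
  rw [← e.sum_comp, Fintype.sum_prod_type]
  refine Finset.sum_congr rfl fun i _ => ?_
  rw [Matrix.mul_sum, Matrix.sum_mul]
  refine Finset.sum_congr rfl fun j _ => ?_
  have h : (fun v => ((K' v).comp (K v)).op (e (i, j) v)) =
      fun v => (K' v).op (i v) * (K v).op (j v) := by
    funext v
    change (K' v).op (finProdFinEquiv.symm (finProdFinEquiv (i v, j v))).1 *
      (K v).op (finProdFinEquiv.symm (finProdFinEquiv (i v, j v))).2 = _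
    rw [Equiv.symm_apply_apply]
  rw [h, ← tensorOp_mul, Matrix.conjTranspose_mul]
  simp only [Matrix.mul_assoc]

/-- An LOCC map with `k` rounds is a sum of products of local completely positive maps; in each
term at most `k` nodes apply a map which is not trace preserving. -/
theorem IsLOCC.exists_branches {k : ℕ} {n m : V → ℕ} {Λ : Op n → Op m} (h : IsLOCC k n m Λ) :
    ∃ (I : Type) (_ : Fintype I) (K : I → (v : V) → Kraus (n v) (m v)) (S : I → Finset V),
      (∀ i, (S i).card ≤ k) ∧ (∀ i, ∀ v ∉ S i, (K i v).IsChannel) ∧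
      ∀ τ, Λ τ = ∑ i, productMap (K i) τ := by
  induction h with
  | localOps K hK =>
    exact ⟨Unit, inferInstance, fun _ => K, fun _ => ∅, by simp, by simpa using hK, by simp⟩
  | @round k n m v N l K hv hu Λ hΛ ih =>
    choose I hI K' S hS hK' hsum using ih
    refine ⟨Σ i, I i, inferInstance, fun p u => (K' p.1 p.2 u).comp (K p.1 u),
      fun p => insert v (S p.1 p.2), fun p => (Finset.card_insert_le _ _).trans ?_,
      fun p u hup => ?_, fun τ => ?_⟩
    · exact Nat.succ_le_succ (hS _ _)
    · rw [Finset.mem_insert, not_or] at hup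
      exact (hK' _ _ _ hup.2).comp (hu _ _ hup.1)
    · rw [Fintype.sum_sigma]
      refine Finset.sum_congr rfl fun i _ => ?_
      rw [hsum]
      refine Finset.sum_congr rfl fun j _ => ?_
      exact productMap_comp _ _ _

theorem posSemidef_productMap {n m : V → ℕ} (K : (v : V) → Kraus (n v) (m v)) {τ : Op n}
    (hτ : τ.PosSemidef) : (productMap K τ).PosSemidef :=
  Matrix.posSemidef_sum _ fun _ _ => hτ.mul_mul_conjTranspose_same _

/-- The matrix is an entrywise product of pullbacks of the source states, so the Schur product
theorem applies, one source at a time. -/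
theorem IsNetworkState.posSemidef {G : Network V} {n : V → ℕ} {τ : Op n}
    (h : IsNetworkState G τ) : τ.PosSemidef := by
  obtain ⟨D, φ, γ, hγ, hτ⟩ := h
  have key : ∀ s : Finset {e // e ∈ G.edges}, (Matrix.of fun x y : Idx n => ∏ e ∈ s,
      γ e.1 (fun v => φ v.1 (x v.1) ⟨e.1, e.2, v.2⟩)
        (fun v => φ v.1 (y v.1) ⟨e.1, e.2, v.2⟩)).PosSemidef := by
    intro s
    induction s using Finset.induction_on with
    | empty =>
      have : (Matrix.of fun _ _ : Idx n => (1 : ℂ)) = Matrix.vecMulVec 1 (star 1) := by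
        ext; simp [Matrix.vecMulVec]
      simpa [this] using Matrix.posSemidef_vecMulVec_self_star (1 : Idx n → ℂ)
    | insert e s he ih =>
      refine Eq.mp (congrArg _ ?_) (((hγ e.1 e.2).1.submatrix
        (fun x : Idx n => fun v : {v // v ∈ e.1} => φ v.1 (x v.1) ⟨e.1, e.2, v.2⟩)).hadamard ih)
      ext x y
      simp [Finset.prod_insert he]
  convert key Finset.univ using 1
  ext x y
  exact hτ x y

/-- The matrix of a completely positive map in the basis of matrix units. -/
def Kraus.coeff {n m : ℕ} (K : Kraus n m) (x y : Fin m) (z w : Fin n) : ℂ :=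
  ∑ j, K.op j x z * star (K.op j y w)

theorem productMap_apply {n m : V → ℕ} (K : (v : V) → Kraus (n v) (m v)) (τ : Op n)
    (x y : Idx m) :
    productMap K τ x y =
      ∑ z, ∑ w, (∏ v, (K v).coeff (x v) (y v) (z v) (w v)) * τ z w := by
  simp only [Kraus.coeff, Fintype.prod_sum, productMap, Matrix.sum_apply, Matrix.mul_apply,
    tensorOp, Matrix.of_apply, Matrix.conjTranspose_apply, Finset.sum_mul, star_prod]
  rw [Finset.sum_comm]
  rw [Finset.sum_comm]
  simp_rw [Finset.sum_comm (s := (Finset.univ : Finset ((v : V) → Fin (K v).rank)))]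
  rw [Finset.sum_comm]
  refine Finset.sum_congr rfl fun z _ => Finset.sum_congr rfl fun w _ =>
    Finset.sum_congr rfl fun j _ => ?_
  rw [Finset.prod_mul_distrib]
  ring

theorem Kraus.sum_coeff {n m : ℕ} (K : Kraus n m) (z w : Fin n) :
    ∑ x, K.coeff x x z w = K.gram w z := by
  simp only [Kraus.coeff, Kraus.gram, Matrix.sum_apply, Matrix.mul_apply,
    Matrix.conjTranspose_apply]
  rw [Finset.sum_comm]
  simp only [mul_comm]

/-- Tracing out the output of a channel traces out its input. This Kronecker delta is what later
splits over the particles of a node. -/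
theorem Kraus.IsChannel.sum_coeff {n m : ℕ} {K : Kraus n m} (h : K.IsChannel) (z w : Fin n) :
    ∑ x, K.coeff x x z w = if z = w then 1 else 0 := by
  rw [Kraus.sum_coeff, h, Matrix.one_apply]
  simp only [eq_comm]

end Branches

/-! ### Product form of reduced operators -/

section Factorization

variable {V : Type*} [Fintype V] [DecidableEq V]

/-- The partial trace of a product over the nodes is taken factor by factor. The labelling `x₀` is
only a dummy: its entries at `u` and `v` are overwritten and the others are not used. -/
theorem reducedPair_productMap_apply {n m : V → ℕ} (K : (v : V) → Kraus (n v) (m v)) (τ : Op n)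
    {u v : V} (huv : u ≠ v) (x₀ : Idx m) (a b : Fin (m u) × Fin (m v)) :
    reducedPair (productMap K τ) u v a b = ∑ z, ∑ w,
      (∏ r, if r = u ∨ r = v then
        (K r).coeff (Function.update (Function.update x₀ u a.1) v a.2 r)
          (Function.update (Function.update x₀ u b.1) v b.2 r) (z r) (w r)
        else ∑ t, (K r).coeff t t (z r) (w r)) * τ z w := by
  have key : ∀ z w : Idx n, (∑ x : Idx m, if x u = a.1 ∧ x v = a.2 then
      ∏ r, (K r).coeff (x r) (Function.update (Function.update x u b.1) v b.2 r) (z r) (w r)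
      else 0) = ∏ r, if r = u ∨ r = v then
        (K r).coeff (Function.update (Function.update x₀ u a.1) v a.2 r)
          (Function.update (Function.update x₀ u b.1) v b.2 r) (z r) (w r)
        else ∑ t, (K r).coeff t t (z r) (w r) := by
    intro z w
    -- The factors at `u` and `v` also become sums, with an indicator, so that distributivity
    -- applies to the whole product.
    have h1 : ∀ r, (if r = u ∨ r = v then
        (K r).coeff (Function.update (Function.update x₀ u a.1) v a.2 r)
          (Function.update (Function.update x₀ u b.1) v b.2 r) (z r) (w r)
        else ∑ t, (K r).coeff t t (z r) (w r)) =
        ∑ t, if r = u ∨ r = v then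
          if t = Function.update (Function.update x₀ u a.1) v a.2 r then
            (K r).coeff t (Function.update (Function.update x₀ u b.1) v b.2 r) (z r) (w r) else 0
        else (K r).coeff t t (z r) (w r) := by
      intro r
      split_ifs with h
      · rw [Finset.sum_ite_eq' Finset.univ, if_pos (Finset.mem_univ _)]
      · rfl
    simp only [h1]
    rw [Fintype.prod_sum]
    refine Finset.sum_congr rfl fun x _ => ?_
    split_ifs with hx
    · refine Finset.prod_congr rfl fun r _ => ?_
      by_cases hv : r = v
      · subst hv; simp [hx.2]
      by_cases hu : r = u
      · subst hu; simp [hx.1, hv]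
      · simp [hu, hv]
    · symm
      rw [not_and_or] at hx
      rcases hx with hx | hx
      · exact Finset.prod_eq_zero (Finset.mem_univ u) (by simp [huv, hx])
      · exact Finset.prod_eq_zero (Finset.mem_univ v) (by simp [hx])
  simp only [← key, reducedPair, Matrix.of_apply, productMap_apply, Finset.sum_mul]
  rw [Finset.sum_congr rfl fun z _ => Finset.sum_comm, Finset.sum_comm]
  refine Finset.sum_congr rfl fun x _ => ?_
  split_ifs <;> simp

/-- Here `mix z y` takes one half of the variables from `z` and the rest from `y`; `F` sees only the
first half and `H` only the second. Exchanging halves is an involution on pairs that turns `F z * H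
y` into `F z * H z`. No explicit splitting of `P` as a product is needed, at the cost of the factor
`card P`. -/
theorem card_mul_sum_mul_of_mix {P : Type*} [Fintype P] (mix : P → P → P)
    (hmix : ∀ z y, mix (mix z y) (mix y z) = z) (F H : P → ℂ)
    (hF : ∀ z y, F (mix z y) = F z) (hH : ∀ z y, H (mix y z) = H z) :
    (Fintype.card P : ℂ) * ∑ z, F z * H z = (∑ z, F z) * ∑ z, H z := by
  have hinv : Function.Involutive fun p : P × P => (mix p.1 p.2, mix p.2 p.1) :=
    fun p => by simp [hmix]
  have h := Equiv.sum_comp hinv.toPerm fun p : P × P => F p.1 * H p.2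
  simp only [Function.Involutive.coe_toPerm, hF, hH] at h
  rw [Finset.sum_mul_sum, ← Fintype.sum_prod_type' (f := fun i j => F i * H j), ← h,
    Fintype.sum_prod_type, Finset.mul_sum]
  simp

open Classical in
/-- If the nodes outside of `T` apply channels and no source connects nodes of `T` inside of `A` to
nodes of `T` outside of `A`, then the reduced operator on a node of `T` in `A` and a node of `T` not
in `A` is a product. -/
theorem exists_reducedPair_eq_kronecker {G : Network V} {n m : V → ℕ} {τ : Op n}
    (hτ : IsNetworkState G τ) (K : (v : V) → Kraus (n v) (m v)) (T : Set V)
    (hK : ∀ w ∉ T, (K w).IsChannel) {u v : V} (hu : u ∈ T) (hv : v ∈ T) (A : Set V)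
    (huA : u ∈ A) (hvA : v ∉ A)
    (hA : ∀ r ∈ T, ∀ s ∈ T, r ∈ A → G.graph.Adj r s → s ∈ A) :
    ∃ X Y, reducedPair (productMap K τ) u v = X ⊗ₖ Y := by
  have huv : u ≠ v := fun h => hvA (h ▸ huA)
  rcases isEmpty_or_nonempty (Idx m) with hm | ⟨⟨x₀⟩⟩
  · exact ⟨0, 0, by ext a b; simp [reducedPair]⟩
  rcases isEmpty_or_nonempty (Idx n × Idx n) with hn | hn
  · refine ⟨0, 0, ?_⟩
    have : IsEmpty (Idx n) := by
      by_contra h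
      rw [not_isEmpty_iff] at h
      exact hn.elim (h.some, h.some)
    ext a b
    simp [reducedPair_productMap_apply K τ huv x₀]
  obtain ⟨D, φ, γ, hγ, hτ⟩ := hτ
  -- The sources on the side of `A`, including those that do not meet `T`. A node of `T` receives
  -- particles only from sources on its own side.
  let EA : Finset V → Prop := fun e => ∀ w ∈ e, w ∈ T → w ∈ A
  have hEA : ∀ r ∈ T, r ∈ A → ∀ e ∈ G.edges, r ∈ e → EA e := by
    intro r hrT hrA e he hre w hwe hwT
    rcases eq_or_ne r w with rfl | hne
    · exact hrA
    · exact hA r hrT w hwT hrA ⟨hne, e, he, hre, hwe⟩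
  have hnEA : ∀ r ∈ T, r ∉ A → ∀ e : Finset V, r ∈ e → ¬ EA e := fun r hrT hrA e hre h =>
    hrA (h r hre hrT)
  let mix1 : (Finset V → Prop) → Idx n → Idx n → Idx n := fun E z y r => (φ r).symm fun e =>
    if E e.1 then φ r (z r) e else φ r (y r) e
  let mix : Idx n × Idx n → Idx n × Idx n → Idx n × Idx n := fun p q =>
    (mix1 EA p.1 q.1, mix1 EA p.2 q.2)
  have hmix1 : ∀ E z y r e, φ r (mix1 E z y r) e = if E e.1 then φ r (z r) e else φ r (y r) e := by
    intro E z y r e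
    simp [mix1]
  have hmix1_left : ∀ E z y r, (∀ e : G.Incident r, E e.1) → mix1 E z y r = z r := by
    intro E z y r h
    apply (φ r).injective
    funext e
    rw [hmix1, if_pos (h e)]
  have hmix1_right : ∀ E z y r, (∀ e : G.Incident r, ¬ E e.1) → mix1 E z y r = y r := by
    intro E z y r h
    apply (φ r).injective
    funext e
    rw [hmix1, if_neg (h e)]
  have hmix1_mix1 : ∀ z y, mix1 EA (mix1 EA z y) (mix1 EA y z) = z := by
    intro z y
    funext r
    apply (φ r).injective
    funext e
    rw [hmix1, hmix1, hmix1]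
    split_ifs <;> rfl
  have hmix : ∀ z y, mix (mix z y) (mix y z) = z := fun z y =>
    Prod.ext (hmix1_mix1 _ _) (hmix1_mix1 _ _)
  let g : (r : V) → Fin (m r) → Fin (m r) → Fin (n r) → Fin (n r) → ℂ := fun r s t z w =>
    if r = u ∨ r = v then (K r).coeff s t z w else ∑ t, (K r).coeff t t z w
  -- The share of the node `r` in the factor of one side. A node of `T` belongs entirely to one
  -- side; outside of `T` the delta of a channel is a product of deltas over the particles, which
  -- are divided between the sides.
  let loc : (Finset V → Prop) → Set V → (r : V) →
      Fin (m r) → Fin (m r) → Fin (n r) → Fin (n r) → ℂ := fun E B r s t z w =>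
    if r ∈ T then if r ∈ B then g r s t z w else 1
    else if ∀ e : G.Incident r, E e.1 → φ r z e = φ r w e then 1 else 0
  let src : (Finset V → Prop) → Idx n × Idx n → ℂ := fun E p =>
    ∏ e : {e // e ∈ G.edges}, if E e.1 then
      γ e.1 (fun v => φ v.1 (p.1 v.1) ⟨e.1, e.2, v.2⟩)
        (fun v => φ v.1 (p.2 v.1) ⟨e.1, e.2, v.2⟩) else 1
  let F : (Finset V → Prop) → Set V → Idx m → Idx m → Idx n × Idx n → ℂ := fun E B x y p =>
    (∏ r, loc E B r (x r) (y r) (p.1 r) (p.2 r)) * src E p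
  have hFH : ∀ x y p, (∏ r, g r (x r) (y r) (p.1 r) (p.2 r)) * τ p.1 p.2 =
      F EA A x y p * F (fun e => ¬ EA e) Aᶜ x y p := by
    intro x y p
    rw [mul_mul_mul_comm, ← Finset.prod_mul_distrib, ← Finset.prod_mul_distrib, hτ]
    congr 1
    · refine Finset.prod_congr rfl fun r _ => ?_
      by_cases hr : r ∈ T
      · by_cases hrA : r ∈ A <;> simp [loc, hr, hrA]
      · have h1 : r ≠ u := fun h => hr (h ▸ hu)
        have h2 : r ≠ v := fun h => hr (h ▸ hv)
        simp only [loc, g, hr, h1, h2, or_self, if_false, (hK r hr).sum_coeff]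
        by_cases h : p.1 r = p.2 r
        · simp [h]
        · rw [if_neg h]
          symm
          rw [mul_eq_zero]
          by_contra hcon
          rw [not_or] at hcon
          apply h
          apply (φ r).injective
          funext e
          by_cases he : EA e.1
          · by_contra h6
            exact hcon.1 (if_neg fun h7 => h6 (h7 e he))
          · by_contra h6
            exact hcon.2 (if_neg fun h7 => h6 (h7 e he))
    · refine Finset.prod_congr rfl fun e _ => ?_
      by_cases he : EA e.1 <;> simp [he]
  have hinv : ∀ (E : Finset V → Prop) (B : Set V) x y (p q : Idx n × Idx n),
      (∀ r ∈ T, r ∈ B → p.1 r = q.1 r ∧ p.2 r = q.2 r) →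
      (∀ r (e : G.Incident r), E e.1 → φ r (p.1 r) e = φ r (q.1 r) e ∧
        φ r (p.2 r) e = φ r (q.2 r) e) → F E B x y p = F E B x y q := by
    intro E B x y p q h1 h2
    change _ * _ = _ * _
    congr 1
    · refine Finset.prod_congr rfl fun r _ => ?_
      change ite _ _ _ = ite _ _ _
      split_ifs with hr hB h3 h4 h4
      · rw [(h1 r hr hB).1, (h1 r hr hB).2]
      · rfl
      · rfl
      · exact absurd (fun e he => by rw [← (h2 r e he).1, ← (h2 r e he).2, h3 e he]) h4
      · exact absurd (fun e he => by rw [(h2 r e he).1, (h2 r e he).2, h4 e he]) h3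
      · rfl
    · refine Finset.prod_congr rfl fun e _ => ?_
      split_ifs with he
      · congr 1 <;> funext r
        · exact (h2 r.1 ⟨e.1, e.2, r.2⟩ he).1
        · exact (h2 r.1 ⟨e.1, e.2, r.2⟩ he).2
      · rfl
  have hF : ∀ x y z y', F EA A x y (mix z y') = F EA A x y z := by
    refine fun x y z y' => hinv EA A x y (mix z y') z (fun r hr hrA => ?_) fun r e he => ?_
    · have h : ∀ e : G.Incident r, EA e.1 := fun e => hEA r hr hrA e.1 e.2.1 e.2.2
      exact ⟨hmix1_left _ _ _ _ h, hmix1_left _ _ _ _ h⟩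
    · exact ⟨(hmix1 _ _ _ _ _).trans (if_pos he), (hmix1 _ _ _ _ _).trans (if_pos he)⟩
  have hH : ∀ x y z y', F (fun e => ¬ EA e) Aᶜ x y (mix y' z) =
      F (fun e => ¬ EA e) Aᶜ x y z := by
    refine fun x y z y' => hinv (fun e => ¬ EA e) Aᶜ x y (mix y' z) z
      (fun r hr hrA => ?_) fun r e he => ?_
    · have h : ∀ e : G.Incident r, ¬ EA e.1 := fun e => hnEA r hr hrA e.1 e.2.2
      exact ⟨hmix1_right _ _ _ _ h, hmix1_right _ _ _ _ h⟩
    · exact ⟨(hmix1 _ _ _ _ _).trans (if_neg he), (hmix1 _ _ _ _ _).trans (if_neg he)⟩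
  -- The inverse cardinality cancels the factor in `card_mul_sum_mul_of_mix`.
  refine ⟨Matrix.of fun a b => (Fintype.card (Idx n × Idx n) : ℂ)⁻¹ *
      ∑ p, F EA A (Function.update x₀ u a) (Function.update x₀ u b) p,
    Matrix.of fun a b => ∑ p, F (fun e => ¬ EA e) Aᶜ (Function.update x₀ v a)
      (Function.update x₀ v b) p, ?_⟩
  ext a b
  rw [reducedPair_productMap_apply K τ huv x₀, Matrix.kroneckerMap_apply, Matrix.of_apply,
    Matrix.of_apply, ← Fintype.sum_prod_type' (f := fun z w => _ * τ z w)]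
  have hcard : (Fintype.card (Idx n × Idx n) : ℂ) ≠ 0 :=
    Nat.cast_ne_zero.2 Fintype.card_ne_zero
  have h1 : ∀ p, F EA A (Function.update (Function.update x₀ u a.1) v a.2)
      (Function.update (Function.update x₀ u b.1) v b.2) p =
      F EA A (Function.update x₀ u a.1) (Function.update x₀ u b.1) p := by
    intro p
    change _ * _ = _ * _
    congr 1
    refine Finset.prod_congr rfl fun r _ => ?_
    by_cases hr : r = v
    · subst hr
      simp [loc, hv, hvA]
    · simp [hr]
  have h2 : ∀ p, F (fun e => ¬ EA e) Aᶜ (Function.update (Function.update x₀ u a.1) v a.2)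
      (Function.update (Function.update x₀ u b.1) v b.2) p =
      F (fun e => ¬ EA e) Aᶜ (Function.update x₀ v a.2) (Function.update x₀ v b.2) p := by
    intro p
    change _ * _ = _ * _
    congr 1
    rw [Function.update_comm huv, Function.update_comm huv]
    refine Finset.prod_congr rfl fun r _ => ?_
    by_cases hr : r = u
    · subst hr
      simp [loc, hu, huA]
    · simp [hr]
  have h3 := card_mul_sum_mul_of_mix mix hmix
    (F EA A (Function.update x₀ u a.1) (Function.update x₀ u b.1))
    (F (fun e => ¬ EA e) Aᶜ (Function.update x₀ v a.2) (Function.update x₀ v b.2))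
    (hF _ _) (hH _ _)
  rw [mul_assoc, ← h3, inv_mul_cancel_left₀ hcard]
  refine Finset.sum_congr rfl fun p _ => ?_
  rw [← h1, ← h2, ← hFH]

end Factorization

/-! ### Overlap with a pure state, compactness of the state space -/

section PureStates

variable {ι : Type*} [Fintype ι]

open scoped MatrixOrder in
theorem exists_eq_conjTranspose_mul_self {σ : Matrix ι ι ℂ} (hσ : σ.PosSemidef) :
    ∃ B : Matrix ι ι ℂ, σ = Bᴴ * B := by
  classical
  exact CStarAlgebra.nonneg_iff_eq_star_mul_self.mp hσ.nonneg

/-- The probability of finding `σ` in the pure state `ψ`. -/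
def overlap (ψ : ι → ℂ) (σ : Matrix ι ι ℂ) : ℝ := (star ψ ⬝ᵥ σ *ᵥ ψ).re

theorem overlap_smul (ψ : ι → ℂ) (c : ℝ) (σ : Matrix ι ι ℂ) :
    overlap ψ (c • σ) = c * overlap ψ σ := by
  simp [overlap, Matrix.smul_mulVec]

theorem overlap_sum (ψ : ι → ℂ) {κ : Type*} (s : Finset κ) (σ : κ → Matrix ι ι ℂ) :
    overlap ψ (∑ i ∈ s, σ i) = ∑ i ∈ s, overlap ψ (σ i) := by
  simp [overlap, Matrix.sum_mulVec, dotProduct_sum]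

theorem continuous_overlap (ψ : ι → ℂ) : Continuous (overlap ψ) := by
  unfold overlap
  fun_prop

theorem overlap_self {ψ : ι → ℂ} (hψ : star ψ ⬝ᵥ ψ = 1) :
    overlap ψ (Matrix.vecMulVec ψ (star ψ)) = 1 := by
  simp [overlap, Matrix.vecMulVec_mulVec, hψ]

/-- With `σ = Bᴴ * B` and `P` the projection onto `ψ`, one minus the overlap is the squared
Hilbert–Schmidt norm of `B * (1 - P)`. If it vanishes, then `σ = P * σ * P = P`. -/
theorem IsState.overlap_le_one [DecidableEq ι] {ψ : ι → ℂ} (hψ : star ψ ⬝ᵥ ψ = 1)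
    {σ : Matrix ι ι ℂ} (hσ : IsState σ) :
    overlap ψ σ ≤ 1 ∧ (overlap ψ σ = 1 → σ = Matrix.vecMulVec ψ (star ψ)) := by
  set P := Matrix.vecMulVec ψ (star ψ) with hP
  have hPH : Pᴴ = P := by simp [hP, Matrix.conjTranspose_vecMulVec]
  have hPP : P * P = P := by
    rw [hP, Matrix.vecMulVec_mul_vecMulVec, hψ, one_smul]
  obtain ⟨B, hB⟩ := exists_eq_conjTranspose_mul_self hσ.1
  have hσP : (σ * P).trace = star ψ ⬝ᵥ σ *ᵥ ψ := by
    rw [hP, Matrix.mul_vecMulVec, Matrix.trace_vecMulVec, dotProduct_comm]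
  have htr : ((B * (1 - P))ᴴ * (B * (1 - P))).trace = 1 - star ψ ⬝ᵥ σ *ᵥ ψ := by
    have h1 : (B * (1 - P))ᴴ * (B * (1 - P)) = (1 - P) * (σ * (1 - P)) := by
      rw [hB, Matrix.conjTranspose_mul, Matrix.conjTranspose_sub, hPH,
        Matrix.conjTranspose_one]
      simp only [Matrix.mul_assoc]
    rw [h1, Matrix.trace_mul_comm, Matrix.mul_assoc]
    have h2 : (1 - P) * (1 - P) = 1 - P := by
      simp [sub_mul, mul_sub, hPP]
    rw [h2, Matrix.mul_sub, Matrix.mul_one, Matrix.trace_sub, hσ.2, hσP]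
  have hnn := (Matrix.posSemidef_conjTranspose_mul_self (B * (1 - P))).trace_nonneg
  rw [htr] at hnn
  have hre := (Complex.nonneg_iff.1 hnn).1
  have him := (Complex.nonneg_iff.1 hnn).2
  refine ⟨by simpa [overlap] using hre, fun h => ?_⟩
  have hz : star ψ ⬝ᵥ σ *ᵥ ψ = 1 := by
    apply Complex.ext
    · exact h
    · simpa using him.symm
  rw [hz, sub_self, Matrix.trace_conjTranspose_mul_self_eq_zero_iff] at htr
  have h1 : σ * P = σ := by
    have : σ * (1 - P) = 0 := by rw [hB, Matrix.mul_assoc, htr, Matrix.mul_zero]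
    rw [Matrix.mul_sub, Matrix.mul_one, sub_eq_zero] at this
    exact this.symm
  have h2 : P * σ = σ := by
    have := congrArg Matrix.conjTranspose h1
    rwa [Matrix.conjTranspose_mul, hPH, hσ.1.isHermitian] at this
  have h3 : P * (σ * P) = P := by
    rw [hP, Matrix.mul_vecMulVec, Matrix.vecMulVec_mul_vecMulVec, hz, one_smul]
  rw [← h3, h1, h2]

/-- States are the image of the Hilbert–Schmidt unit sphere under `B ↦ Bᴴ * B`. -/
theorem isCompact_setOf_isState : IsCompact {σ : Matrix ι ι ℂ | IsState σ} := by
  classical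
  have hent : ∀ B : Matrix ι ι ℂ, (Bᴴ * B).trace = ((∑ j, ∑ i, ‖B i j‖ ^ 2 : ℝ) : ℂ) := by
    intro B
    simp only [Matrix.trace, Matrix.diag, Matrix.mul_apply, Matrix.conjTranspose_apply]
    push_cast
    refine Finset.sum_congr rfl fun j _ => Finset.sum_congr rfl fun i _ => ?_
    rw [← Complex.conj_mul']
    rfl
  have h1 : IsCompact {B : Matrix ι ι ℂ | (Bᴴ * B).trace = 1} := by
    have hK : IsCompact (Set.univ.pi fun _ : ι => Set.univ.pi fun _ : ι =>
        Metric.closedBall (0 : ℂ) 1) :=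
      isCompact_univ_pi fun _ => isCompact_univ_pi fun _ => isCompact_closedBall _ _
    refine IsCompact.of_isClosed_subset hK (isClosed_eq ?_ continuous_const) ?_
    · fun_prop
    · intro B hB i _ j _
      rw [Set.mem_ofPred_eq, hent] at hB
      have hB' : (∑ j, ∑ i, ‖B i j‖ ^ 2 : ℝ) = 1 := by exact_mod_cast hB
      rw [mem_closedBall_zero_iff, ← sq_le_one_iff₀ (norm_nonneg _), ← hB']
      calc ‖B i j‖ ^ 2 ≤ ∑ i, ‖B i j‖ ^ 2 :=
            Finset.single_le_sum (f := fun i => ‖B i j‖ ^ 2) (fun _ _ => sq_nonneg _)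
              (Finset.mem_univ i)
        _ ≤ _ := Finset.single_le_sum (f := fun j => ∑ i, ‖B i j‖ ^ 2)
              (fun _ _ => Finset.sum_nonneg fun _ _ => sq_nonneg _) (Finset.mem_univ j)
  have h2 : {σ : Matrix ι ι ℂ | IsState σ} =
      (fun B : Matrix ι ι ℂ => Bᴴ * B) '' {B | (Bᴴ * B).trace = 1} := by
    ext σ
    constructor
    · rintro ⟨hσ, htr⟩
      obtain ⟨B, rfl⟩ := exists_eq_conjTranspose_mul_self hσ
      exact ⟨B, htr, rfl⟩
    · rintro ⟨B, hB, rfl⟩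
      exact ⟨Matrix.posSemidef_conjTranspose_mul_self B, hB⟩
  rw [h2]
  exact h1.image (by fun_prop)

/-- If a product operator is a state, then it is a product of states. -/
theorem IsState.exists_kronecker {κ : Type*} [Fintype κ] {X : Matrix ι ι ℂ} {Y : Matrix κ κ ℂ}
    (h : IsState (X ⊗ₖ Y)) : ∃ A B, IsState A ∧ IsState B ∧ X ⊗ₖ Y = A ⊗ₖ B := by
  have htr : X.trace * Y.trace = 1 := by rw [← Matrix.trace_kronecker]; exact h.2
  -- The two factors are the partial traces, hence sums of principal submatrices; the scalars
  -- multiply to `1`.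
  refine ⟨Y.trace • X, X.trace • Y, ⟨?_, ?_⟩, ⟨?_, ?_⟩, ?_⟩
  · have := Matrix.posSemidef_sum Finset.univ fun (k : κ) _ =>
      h.1.submatrix fun i : ι => (i, k)
    refine Eq.mp (congrArg _ ?_) this
    ext i j
    simp [Matrix.sum_apply, Matrix.trace, Finset.mul_sum, mul_comm]
  · rw [Matrix.trace_smul, smul_eq_mul, mul_comm, htr]
  · have := Matrix.posSemidef_sum Finset.univ fun (k : ι) _ =>
      h.1.submatrix fun i : κ => (k, i)
    refine Eq.mp (congrArg _ ?_) this
    ext i j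
    simp [Matrix.sum_apply, Matrix.trace, Finset.sum_mul]
  · rw [Matrix.trace_smul, smul_eq_mul, htr]
  · rw [Matrix.smul_kronecker, Matrix.kronecker_smul, smul_smul, mul_comm, htr, one_smul]

end PureStates

/-! ### Reduced states and the gap in overlap -/

section ReducedPair

variable {V : Type*} [Fintype V] [DecidableEq V] {d : V → ℕ}

theorem reducedPair_smul (c : ℝ) (ρ : Op d) (u v : V) :
    reducedPair (c • ρ) u v = c • reducedPair ρ u v := by
  ext a b
  simp only [reducedPair, Matrix.of_apply, Matrix.smul_apply, Finset.smul_sum]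
  refine Finset.sum_congr rfl fun x _ => ?_
  split_ifs <;> simp

theorem continuous_reducedPair (u v : V) :
    Continuous fun ρ : Op d => reducedPair ρ u v := by
  refine continuous_matrix fun a b => ?_
  simp only [reducedPair, Matrix.of_apply]
  refine continuous_finsetSum _ fun x _ => ?_
  split_ifs
  · fun_prop
  · exact continuous_const

theorem trace_reducedPair (ρ : Op d) (u v : V) :
    (reducedPair ρ u v).trace = ρ.trace := by
  simp only [Matrix.trace, Matrix.diag, reducedPair, Matrix.of_apply]
  rw [Finset.sum_comm]
  refine Finset.sum_congr rfl fun x _ => ?_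
  rw [Finset.sum_eq_single (x u, x v)]
  · simp
  · intro b _ hb
    rw [if_neg]
    rintro ⟨h1, h2⟩
    exact hb (Prod.ext h1.symm h2.symm)
  · simp

/-- A partial trace is a sum of principal submatrices, one for each labelling of the other nodes;
such labellings are represented by the `x` that agree with `x₀` at `u` and `v`. -/
theorem posSemidef_reducedPair {ρ : Op d} (hρ : ρ.PosSemidef) {u v : V} (huv : u ≠ v) :
    (reducedPair ρ u v).PosSemidef := by
  rcases isEmpty_or_nonempty (Idx d) with hd | ⟨⟨x₀⟩⟩
  · refine Eq.mp (congrArg _ ?_) Matrix.PosSemidef.zero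
    ext
    simp [reducedPair]
  let up : Idx d → Fin (d u) × Fin (d v) → Idx d := fun x a =>
    Function.update (Function.update x u a.1) v a.2
  have hsum := Matrix.posSemidef_sum (Finset.univ.filter fun x : Idx d => x u = x₀ u ∧ x v = x₀ v)
    fun x _ => hρ.submatrix (up x)
  refine Eq.mp (congrArg _ ?_) hsum
  ext a b
  simp only [Matrix.sum_apply, Matrix.submatrix_apply, reducedPair, Matrix.of_apply]
  rw [← Finset.sum_filter]
  refine Finset.sum_nbij' (fun x => up x a) (fun x => up x (x₀ u, x₀ v)) ?_ ?_ ?_ ?_ ?_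
  · intro x _
    simp [up, huv]
  · intro x _
    simp [up, huv]
  · intro x hx
    simp only [Finset.mem_filter] at hx
    funext r
    by_cases hv : r = v
    · subst hv; simp [up, hx.2.2]
    by_cases hu : r = u
    · subst hu; simp [up, hx.2.1, hv]
    · simp [up, hu, hv]
  · intro x hx
    simp only [Finset.mem_filter] at hx
    funext r
    by_cases hv : r = v
    · subst hv; simp [up, hx.2.2]
    by_cases hu : r = u
    · subst hu; simp [up, hx.2.1, hv]
    · simp [up, hu, hv]
  · intro x _
    congr 1
    funext r
    by_cases hv : r = v
    · subst hv; simp [up]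
    by_cases hu : r = u
    · subst hu; simp [up, hv]
    · simp [up, hu, hv]

theorem IsState.reducedPair {ρ : Op d} (hρ : IsState ρ) {u v : V} (huv : u ≠ v) :
    IsState (reducedPair ρ u v) :=
  ⟨posSemidef_reducedPair hρ.1 huv, (trace_reducedPair ρ u v).trans hρ.2⟩

/-- The states for which the reduced state on some pair of distinct non-adjacent nodes is a
product. -/
def productPairStates (G : Network V) (d : V → ℕ) : Set (Op d) :=
  ⋃ p ∈ {p : V × V | p.1 ≠ p.2 ∧ ¬ G.graph.Adj p.1 p.2},
    {σ | IsState σ} ∩ (fun σ : Op d => QNet.reducedPair σ p.1 p.2) ⁻¹'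
      ((fun q : Matrix _ _ ℂ × Matrix _ _ ℂ => q.1 ⊗ₖ q.2) '' ({A | IsState A} ×ˢ {B | IsState B}))

theorem isCompact_productPairStates (G : Network V) (d : V → ℕ) :
    IsCompact (productPairStates G d) := by
  refine (Set.toFinite _).isCompact_biUnion fun p _ => ?_
  refine isCompact_setOf_isState.inter_right (IsClosed.preimage (continuous_reducedPair _ _) ?_)
  refine ((isCompact_setOf_isState.prod isCompact_setOf_isState).image ?_).isClosed
  refine continuous_matrix fun a b => ?_
  simp only [Matrix.kroneckerMap_apply]
  fun_prop

/-- The overlap of a pure state that is entangled between any two distinct non-adjacent nodes with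
the states in `productPairStates` is bounded away from one. -/
theorem exists_overlap_le_of_mem_productPairStates (G : Network V) {ψ : Idx d → ℂ}
    (hψ : star ψ ⬝ᵥ ψ = 1)
    (hent : ∀ u v : V, u ≠ v → ¬ G.graph.Adj u v →
      ¬ IsSeparable (QNet.reducedPair (Matrix.vecMulVec ψ (star ψ)) u v)) :
    ∃ c < 1, ∀ σ ∈ productPairStates G d, overlap ψ σ ≤ c := by
  rcases (productPairStates G d).eq_empty_or_nonempty with he | hne
  · exact ⟨0, one_pos, by simp [he]⟩
  obtain ⟨σ, hσ, hmax⟩ := (isCompact_productPairStates G d).exists_isMaxOn hne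
    (continuous_overlap ψ).continuousOn
  refine ⟨overlap ψ σ, ?_, fun τ hτ => hmax hτ⟩
  simp only [productPairStates, Set.mem_iUnion] at hσ
  obtain ⟨p, hp, hst, ⟨A, B⟩, hAB, hred⟩ := hσ
  -- Overlap one would make the maximizer equal to the given pure state, which has no product
  -- reduced state on a non-adjacent pair.
  refine lt_of_le_of_ne (hst.overlap_le_one hψ).1 fun h => ?_
  refine hent p.1 p.2 hp.1 hp.2 (subset_convexHull ℝ _ ⟨A, B, hAB.1, hAB.2, ?_⟩)
  rw [← (hst.overlap_le_one hψ).2 h]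
  exact hred.symm

end ReducedPair

/-! ### A criterion for connected dominating sets -/

section Domination

variable {V : Type*}

/-- If any two distinct non-adjacent nodes `u` and `v` are connected inside of `S ∪ {u, v}`, then
`S` is a connected dominating set. -/
theorem isConnectedDominating_of_forall_reachable {G : Network V} (hG : ¬ G.IsComplete)
    (S : Finset V)
    (h : ∀ u v, u ≠ v → ¬ G.graph.Adj u v → ∀ A : Set V, u ∈ A →
      (∀ r ∈ insert u (insert v (S : Set V)), ∀ s ∈ insert u (insert v (S : Set V)), r ∈ A →
        G.graph.Adj r s → s ∈ A) → v ∈ A) :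
    G.IsConnectedDominating S := by
  have hne : S.Nonempty := by
    simp only [Network.IsComplete, not_forall] at hG
    obtain ⟨u, v, huv, hadj⟩ := hG
    by_contra hS
    rw [Finset.not_nonempty_iff_eq_empty] at hS
    subst hS
    -- Reachability is expressed by sets closed under adjacency. For empty `S`, the set `{u}` is
    -- closed, since `u` and `v` are not adjacent.
    refine huv (h u v huv hadj {u} rfl ?_).symm
    rintro r - s (rfl | hs) hr hrs
    · rfl
    · rw [Finset.coe_empty, Set.mem_insert_iff, or_iff_left (Set.notMem_empty s)] at hs
      rw [Set.mem_singleton_iff] at hr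
      subst hr hs
      exact absurd hrs hadj
  have hdom : ∀ v, v ∈ S ∨ ∃ s ∈ S, G.graph.Adj s v := by
    intro v
    by_contra hv
    push Not at hv
    obtain ⟨s, hs⟩ := hne
    refine hv.1 ?_
    have hvs : v ≠ s := fun h => hv.1 (h ▸ hs)
    -- An undominated node has no neighbour in `S`, so its singleton is closed.
    have := h v s hvs (fun h => hv.2 s hs h.symm) {v} rfl ?_
    · rw [Set.mem_singleton_iff] at this
      exact this ▸ hs
    rintro r - t (rfl | rfl | ht) hr hrt
    · rfl
    · rw [Set.mem_singleton_iff] at hr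
      subst hr
      exact absurd hrt.symm (hv.2 _ hs)
    · rw [Set.mem_singleton_iff] at hr
      subst hr
      exact absurd hrt.symm (hv.2 _ ht)
  have : Nonempty (S : Set V) := hne.to_subtype
  refine ⟨⟨fun a b => ?_⟩, hdom⟩
  rcases eq_or_ne a b with rfl | hab
  · exact SimpleGraph.Reachable.refl _
  by_cases hadj : G.graph.Adj a b
  · exact SimpleGraph.Adj.reachable (by simpa using hadj)
  have hab' : (a : V) ≠ b := fun h => hab (Subtype.ext h)
  -- The closed set used here is the component of `a` in the subgraph induced by `S`.
  obtain ⟨hb, hr⟩ := h a b hab' hadj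
    {r | ∃ hr : r ∈ (S : Set V), (G.graph.induce (S : Set V)).Reachable a ⟨r, hr⟩}
    ⟨a.2, SimpleGraph.Reachable.refl _⟩ (by
      rintro r - s hs ⟨hr, hreach⟩ hrs
      have hs' : s ∈ (S : Set V) := by
        rcases hs with rfl | rfl | hs
        · exact a.2
        · exact b.2
        · exact hs
      refine ⟨hs', hreach.trans (SimpleGraph.Adj.reachable ?_)⟩
      simpa using hrs)
  exact hr

end Domination

/-! ### The lower bound -/

section LowerBound

variable {V : Type*} [Fintype V] [DecidableEq V] {d : V → ℕ}

/-- If no connected dominating set has at most `k` elements, then every operator that can be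
prepared with `k` rounds satisfies a bound on its overlap with a state that is far from
`productPairStates`. -/
theorem overlap_le_of_mem_preparable {G : Network V} (hG : ¬ G.IsComplete) {k : ℕ}
    (hk : ∀ S : Finset V, S.card ≤ k → ¬ G.IsConnectedDominating S) (ψ : Idx d → ℂ) {c : ℝ}
    (hc : ∀ σ ∈ productPairStates G d, overlap ψ σ ≤ c) {ρ : Op d} (hρ : ρ ∈ preparable G d k) :
    overlap ψ ρ ≤ c * ρ.trace.re := by
  obtain ⟨n, τ, N, p, Λ, hτ, -, hΛ, rfl⟩ := hρ
  rw [overlap_sum, Matrix.trace_sum, Complex.re_sum, Finset.mul_sum]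
  refine Finset.sum_le_sum fun t _ => ?_
  have hsmul : p t • Λ t τ = (p t : ℝ) • Λ t τ := rfl
  rw [hsmul, overlap_smul, Matrix.trace_smul, Complex.smul_re, smul_eq_mul, mul_left_comm]
  refine mul_le_mul_of_nonneg_left ?_ (p t).2
  obtain ⟨I, _, K, S, hS, hK, hsum⟩ := (hΛ t).exists_branches
  rw [hsum, overlap_sum, Matrix.trace_sum, Complex.re_sum, Finset.mul_sum]
  refine Finset.sum_le_sum fun i _ => ?_
  have hpsd := posSemidef_productMap (K i) hτ.posSemidef
  set B := productMap (K i) τ with hB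
  have htr := Complex.nonneg_iff.1 hpsd.trace_nonneg
  have htr' : B.trace = (B.trace.re : ℂ) := Complex.ext rfl (by simpa using htr.2.symm)
  -- A branch of trace zero cannot be normalized, but being positive semidefinite it vanishes.
  rcases htr.1.eq_or_lt with h0 | hpos
  · rw [← h0, Complex.ofReal_zero, hpsd.trace_eq_zero_iff] at htr'
    simp [htr', overlap]
  set r := B.trace.re
  have hst : IsState (r⁻¹ • B) := by
    constructor
    · have : r⁻¹ • B = ((r⁻¹ : ℝ) : ℂ) • B := by ext; simp
      rw [this]
      exact hpsd.smul (Complex.zero_le_real.2 (inv_nonneg.2 hpos.le))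
    · rw [Matrix.trace_smul, htr', Complex.real_smul, ← Complex.ofReal_mul,
        inv_mul_cancel₀ hpos.ne', Complex.ofReal_one]
  have hmem : r⁻¹ • B ∈ productPairStates G d := by
    have hnot := mt (isConnectedDominating_of_forall_reachable hG (S i)) (hk _ (hS i))
    push Not at hnot
    obtain ⟨u, v, huv, hadj, A, huA, hA, hvA⟩ := hnot
    simp only [productPairStates, Set.mem_iUnion]
    refine ⟨(u, v), ⟨huv, hadj⟩, hst, ?_⟩
    obtain ⟨X, Y, hXY⟩ := exists_reducedPair_eq_kronecker hτ (K i)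
      (insert u (insert v (S i : Set V))) (fun w hw => hK i w fun h => hw (by simp [h]))
      (u := u) (v := v) (by simp) (by simp) A huA hvA hA
    have hred : reducedPair (r⁻¹ • B) u v = (r⁻¹ • X) ⊗ₖ Y := by
      rw [reducedPair_smul, hB, hXY, Matrix.smul_kronecker]
    have hst' := hst.reducedPair huv
    rw [hred] at hst'
    obtain ⟨A', B', hA', hB', hAB⟩ := hst'.exists_kronecker
    exact ⟨(A', B'), ⟨hA', hB'⟩, hAB.symm.trans hred.symm⟩
  have := hc _ hmem
  rw [overlap_smul, inv_mul_le_iff₀ hpos] at this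
  linarith

/-- Otherwise the overlap bound, a closed condition, would extend to the closure and read `1 ≤ c` at
the pure state itself. -/
theorem exists_isConnectedDominating_of_mem_closure {G : Network V} (hG : ¬ G.IsComplete)
    {ψ : Idx d → ℂ} (hψ : star ψ ⬝ᵥ ψ = 1)
    (hent : ∀ u v : V, u ≠ v → ¬ G.graph.Adj u v →
      ¬ IsSeparable (reducedPair (Matrix.vecMulVec ψ (star ψ)) u v)) {k : ℕ}
    (hmem : Matrix.vecMulVec ψ (star ψ) ∈ closure (preparable G d k)) :
    ∃ S : Finset V, S.card ≤ k ∧ G.IsConnectedDominating S := by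
  by_contra hk
  push Not at hk
  obtain ⟨c, hc1, hc⟩ := exists_overlap_le_of_mem_productPairStates G hψ hent
  have hclosed : IsClosed {ρ : Op d | overlap ψ ρ ≤ c * ρ.trace.re} := by
    refine isClosed_le (continuous_overlap ψ) ?_
    fun_prop
  have hsub : preparable G d k ⊆ {ρ : Op d | overlap ψ ρ ≤ c * ρ.trace.re} :=
    fun ρ hρ => overlap_le_of_mem_preparable hG hk ψ hc hρ
  have := closure_minimal hsub hclosed hmem
  rw [Set.mem_ofPred_eq] at this
  rw [overlap_self hψ, Matrix.trace_vecMulVec, dotProduct_comm, hψ,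
    Complex.one_re, mul_one] at this
  linarith

/-- The network round complexity of a pure state is its minimal number of rounds. -/
theorem networkRoundComplexity_of_isPureState (G : Network V) {ρ : Op d} (hρ : IsPureState ρ) :
    networkRoundComplexity G ρ = (minRounds G ρ : ℝ≥0∞) := by
  obtain ⟨ψ, hψ, rfl⟩ := hρ
  apply le_antisymm
  · refine (iInf_le _ 1).trans <| (iInf_le _ fun _ => 1).trans <|
      (iInf_le _ fun _ => Matrix.vecMulVec ψ (star ψ)).trans <| (iInf_le _ ?_).trans ?_
    · refine ⟨by simp, fun _ => ⟨Matrix.posSemidef_vecMulVec_self_star ψ, ?_⟩, by simp⟩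
      rw [Matrix.trace_vecMulVec, dotProduct_comm, hψ]
    · simp
  · refine le_iInf fun N => le_iInf fun p => le_iInf fun σ => le_iInf fun ⟨hp, hσ, hsum⟩ => ?_
    have hover := congrArg (overlap ψ) hsum
    have hsmul : ∀ i, p i • σ i = (p i : ℝ) • σ i := fun _ => rfl
    simp only [hsmul, overlap_self hψ, overlap_sum, overlap_smul] at hover
    have hp' : ∑ i, (p i : ℝ) = 1 := by exact_mod_cast hp
    -- Overlaps are at most one and average to one, so each of positive weight equals one. Terms of
    -- weight zero vanish even if their number of rounds is infinite.
    have heq : ∀ i ∈ Finset.univ, (p i : ℝ) * overlap ψ (σ i) = p i := by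
      rw [← Finset.sum_eq_sum_iff_of_le, ← hover, hp']
      exact fun i _ => mul_le_of_le_one_right (p i).2 ((hσ i).overlap_le_one hψ).1
    have hterm : ∀ i, (p i : ℝ≥0∞) * (minRounds G (σ i) : ℝ≥0∞) =
        p i * (minRounds G (Matrix.vecMulVec ψ (star ψ)) : ℝ≥0∞) := by
      intro i
      rcases eq_or_ne (p i) 0 with h0 | h0
      · simp [h0]
      · have h1 : overlap ψ (σ i) = 1 := by
          have := heq i (Finset.mem_univ i)
          rwa [mul_eq_left₀ (NNReal.coe_ne_zero.2 h0)] at this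
        rw [((hσ i).overlap_le_one hψ).2 h1]
    simp only [hterm]
    rw [← Finset.sum_mul, ← ENNReal.ofNNReal_finsetSum, hp, ENNReal.coe_one, one_mul]

end LowerBound

/-! ### Local operators, isometries and superpositions of basis vectors -/

section LocalOperators

variable {V : Type*} [Fintype V]

/-- The tensor product `⨂_v A_v` of local operators, for arbitrary labels of the bases. -/
def localOp {ι κ : V → Type*} (A : (v : V) → Matrix (κ v) (ι v) ℂ) :
    Matrix ((v : V) → κ v) ((v : V) → ι v) ℂ :=
  Matrix.of fun y x => ∏ v, A v (y v) (x v)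

open Classical in
/-- The superposition `∑ z, ψ z |β z⟩` of basis vectors. -/
def ketSum {α Z : Type*} [Fintype Z] (ψ : Z → ℂ) (β : Z → α) : α → ℂ :=
  fun x => ∑ z, if x = β z then ψ z else 0

open Classical in
/-- The operator that maps the basis vector `|x⟩` to `a x |f x⟩`. -/
def monoOp {α β : Type*} (f : α → β) (a : α → ℂ) : Matrix β α ℂ :=
  Matrix.of fun y x => if y = f x then a x else 0

theorem localOp_mul [DecidableEq V] {ι κ μ : V → Type*} [∀ v, Fintype (κ v)]
    (B : (v : V) → Matrix (μ v) (κ v) ℂ) (A : (v : V) → Matrix (κ v) (ι v) ℂ) :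
    localOp B * localOp A = localOp fun v => B v * A v := by
  ext x z
  simp only [localOp, Matrix.mul_apply, Matrix.of_apply, ← Finset.prod_mul_distrib]
  exact (Fintype.prod_sum fun v j => B v (x v) j * A v j (z v)).symm

theorem mulVec_ketSum {α β Z : Type*} [Fintype α] [Fintype Z] (M : Matrix β α ℂ) (ψ : Z → ℂ)
    (f : Z → α) : M *ᵥ ketSum ψ f = fun y => ∑ z, M y (f z) * ψ z := by
  classical
  funext y
  simp only [Matrix.mulVec, dotProduct, ketSum, Finset.mul_sum]
  rw [Finset.sum_comm]
  refine Finset.sum_congr rfl fun z _ => ?_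
  simp

/-- The operators used for teleportation have this monomial form, so its effect is a computation
with labels and amplitudes. -/
theorem localOp_monoOp_mulVec_ketSum [DecidableEq V] {ι κ : V → Type*} [∀ v, Fintype (ι v)]
    {Z : Type*} [Fintype Z] (f : (v : V) → ι v → κ v) (a : (v : V) → ι v → ℂ) (ψ : Z → ℂ)
    (β : Z → (v : V) → ι v) :
    localOp (fun v => monoOp (f v) (a v)) *ᵥ ketSum ψ β =
      ketSum (fun z => (∏ v, a v (β z v)) * ψ z) fun z v => f v (β z v) := by
  classical
  rw [mulVec_ketSum]
  funext y
  refine Finset.sum_congr rfl fun z _ => ?_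
  simp only [localOp, monoOp, Matrix.of_apply]
  split_ifs with h
  · subst h
    simp
  · obtain ⟨v, hv⟩ := Function.ne_iff.1 h
    rw [Finset.prod_eq_zero (Finset.mem_univ v) (if_neg hv), zero_mul]

theorem monoOp_conjTranspose_mul_monoOp {α β : Type*} [Fintype β] [DecidableEq β] (f : α → β)
    (a : α → ℂ) (x y : α) :
    ((monoOp f a)ᴴ * monoOp f a) x y = if f x = f y then star (a x) * a y else 0 := by
  classical
  simp only [Matrix.mul_apply, Matrix.conjTranspose_apply, monoOp, Matrix.of_apply]
  rw [Finset.sum_eq_single (f x)]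
  · simp
  · intro b _ hb
    simp [hb]
  · simp

open Classical in
/-- Isometries. -/
def IsIsometry {α β : Type*} [Fintype β] (A : Matrix β α ℂ) : Prop := Aᴴ * A = 1

theorem isIsometry_monoOp {α β : Type*} [Fintype β] {f : α → β} (hf : Function.Injective f)
    {a : α → ℂ} (ha : ∀ x, ‖a x‖ = 1) : IsIsometry (monoOp f a) := by
  classical
  ext x y
  rw [monoOp_conjTranspose_mul_monoOp, Matrix.one_apply]
  rcases eq_or_ne x y with rfl | hxy
  · rw [if_pos rfl]
    have := RCLike.conj_mul (a x)
    rw [ha] at this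
    simpa using this
  · rw [if_neg hxy, if_neg fun h => hxy (hf h)]

theorem isIsometry_of_column {α β : Type*} [Fintype β] (hα : ∀ i j : α, i = j) {φ : β → ℂ}
    (hφ : star φ ⬝ᵥ φ = 1) : IsIsometry (Matrix.of fun x (_ : α) => φ x) := by
  classical
  ext i j
  rw [hα i j, Matrix.one_apply_eq]
  exact hφ

theorem IsIsometry.mul {α β γ : Type*} [Fintype β] [Fintype γ] {B : Matrix γ β ℂ}
    {A : Matrix β α ℂ} (hB : IsIsometry B) (hA : IsIsometry A) : IsIsometry (B * A) := by
  classical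
  unfold IsIsometry at *
  rw [Matrix.conjTranspose_mul, Matrix.mul_assoc, ← Matrix.mul_assoc _ B, hB, Matrix.one_mul, hA]

theorem one_mul_one_apply_prod {α γ : Type*} {_ : DecidableEq α} {_ : DecidableEq γ}
    {_ : DecidableEq (α × γ)} (x y : α × γ) :
    (1 : Matrix α α ℂ) x.1 y.1 * (1 : Matrix γ γ ℂ) x.2 y.2 =
      (1 : Matrix (α × γ) (α × γ) ℂ) x y := by
  by_cases h1 : x.1 = y.1 <;> by_cases h2 : x.2 = y.2 <;>
    simp [Matrix.one_apply, Prod.ext_iff, h1, h2]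

open Classical in
theorem IsIsometry.kronecker_one {α β γ : Type*} [Fintype β] [Fintype γ]
    {A : Matrix β α ℂ} (hA : IsIsometry A) : IsIsometry (A ⊗ₖ (1 : Matrix γ γ ℂ)) := by
  unfold IsIsometry at *
  rw [Matrix.conjTranspose_kronecker, Matrix.conjTranspose_one, ← Matrix.mul_kronecker_mul, hA,
    Matrix.mul_one]
  ext x y
  exact one_mul_one_apply_prod x y

end LocalOperators

/-- A vector in `⨂_v ℂ^{ι v}` for some finite sets `ι v` of labels. -/
structure MultiVec (V : Type u) where
  /-- the labels of the bases -/
  ι : V → Type u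
  /-- finiteness of the label sets -/
  fin : ∀ v, Fintype (ι v)
  /-- the coefficients -/
  vec : ((v : V) → ι v) → ℂ

attribute [instance] MultiVec.fin

namespace MultiVec

variable {V : Type u}

/-- The tensor product, node by node. -/
def tensor (P Q : MultiVec V) : MultiVec V where
  ι v := P.ι v × Q.ι v
  fin _ := inferInstance
  vec x := P.vec (fun v => (x v).1) * Q.vec fun v => (x v).2

/-- A superposition of basis vectors. -/
def super (ι : V → Type u) [h : ∀ v, Fintype (ι v)] {Z : Type*} [Fintype Z] (ψ : Z → ℂ)
    (β : Z → (v : V) → ι v) : MultiVec V where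
  ι := ι
  fin := h
  vec := ketSum ψ β

/-- A basis vector. -/
def basis (ι : V → Type u) [h : ∀ v, Fintype (ι v)] (g : (v : V) → ι v) : MultiVec V :=
  super ι (fun _ : Unit => 1) fun _ => g

/-- The vector of nodes without particles. -/
def unit (V : Type u) : MultiVec V := basis (fun _ => PUnit) fun _ => PUnit.unit

theorem ketSum_mul_ketSum {ι κ : V → Type u} {Z Z' : Type*} [Fintype Z] [Fintype Z'] (ψ : Z → ℂ)
    (β : Z → (v : V) → ι v) (ψ' : Z' → ℂ) (β' : Z' → (v : V) → κ v) (x : (v : V) → ι v × κ v) :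
    (ketSum ψ β fun v => (x v).1) * (ketSum ψ' β' fun v => (x v).2) =
      ketSum (fun z : Z × Z' => ψ z.1 * ψ' z.2) (fun z v => (β z.1 v, β' z.2 v)) x := by
  classical
  simp only [ketSum]
  rw [Finset.sum_mul_sum, ← Fintype.sum_prod_type'
    (f := fun i j => (if (fun v => (x v).1) = β i then ψ i else 0) *
      if (fun v => (x v).2) = β' j then ψ' j else 0)]
  refine Finset.sum_congr rfl fun z _ => ?_
  have : x = (fun v => (β z.1 v, β' z.2 v)) ↔
      (fun v => (x v).1) = β z.1 ∧ (fun v => (x v).2) = β' z.2 := by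
    simp only [funext_iff, Prod.ext_iff]
    exact forall_and
  simp only [this]
  split_ifs <;> simp_all

theorem super_tensor_super {ι κ : V → Type u} [∀ v, Fintype (ι v)] [∀ v, Fintype (κ v)]
    {Z Z' : Type*} [Fintype Z] [Fintype Z'] (ψ : Z → ℂ) (β : Z → (v : V) → ι v) (ψ' : Z' → ℂ)
    (β' : Z' → (v : V) → κ v) :
    (super ι ψ β).tensor (super κ ψ' β') = super (fun v => ι v × κ v)
      (fun z : Z × Z' => ψ z.1 * ψ' z.2) fun z v => (β z.1 v, β' z.2 v) := by
  simp only [super, tensor]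
  congr 1
  funext x
  exact ketSum_mul_ketSum ψ β ψ' β' x

theorem super_tensor_basis_vec {ι κ : V → Type u} [∀ v, Fintype (ι v)] [∀ v, Fintype (κ v)]
    {Z : Type*} [Fintype Z] (ψ : Z → ℂ) (β : Z → (v : V) → ι v) (g : (v : V) → κ v)
    (x : (v : V) → ι v × κ v) :
    ((super ι ψ β).tensor (basis κ g)).vec x = ketSum ψ (fun z v => (β z v, g v)) x := by
  refine (ketSum_mul_ketSum ψ β (fun _ : Unit => 1) (fun _ => g) x).trans ?_
  simp [ketSum, Fintype.sum_prod_type]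

theorem super_tensor_basis {ι κ : V → Type u} [∀ v, Fintype (ι v)] [∀ v, Fintype (κ v)]
    {Z : Type*} [Fintype Z] (ψ : Z → ℂ) (β : Z → (v : V) → ι v) (g : (v : V) → κ v) :
    (super ι ψ β).tensor (basis κ g) = super (fun v => ι v × κ v) ψ
      fun z v => (β z v, g v) := by
  change MultiVec.mk _ _ _ = MultiVec.mk _ _ _
  congr 1
  funext x
  exact super_tensor_basis_vec ψ β g x

theorem basis_tensor_basis {ι κ : V → Type u} [∀ v, Fintype (ι v)] [∀ v, Fintype (κ v)]
    (f : (v : V) → ι v) (g : (v : V) → κ v) :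
    (basis ι f).tensor (basis κ g) = basis (fun v => ι v × κ v) fun v => (f v, g v) :=
  super_tensor_basis _ _ _

section Maps

variable [Fintype V] [DecidableEq V]

/-- `Q` is obtained from `P` by local isometries. -/
def LocalIso (P Q : MultiVec V) : Prop :=
  ∃ A : (v : V) → Matrix (Q.ι v) (P.ι v) ℂ, (∀ v, IsIsometry (A v)) ∧ localOp A *ᵥ P.vec = Q.vec

open Classical in
/-- `Q` is obtained deterministically from `P` by an instrument at the node `s`, whose outcome `i`
is broadcast to the other nodes, which apply isometries that depend on `i`. -/
def Step (s : V) (P Q : MultiVec V) : Prop :=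
  ∃ (I : Type) (_ : Fintype I) (A : I → (v : V) → Matrix (Q.ι v) (P.ι v) ℂ) (c : I → ℂ),
    ∑ i, (A i s)ᴴ * A i s = 1 ∧ (∀ i, ∀ v ≠ s, IsIsometry (A i v)) ∧
    (∀ i, localOp (A i) *ᵥ P.vec = c i • Q.vec) ∧ ∑ i, ‖c i‖ ^ 2 = 1

theorem LocalIso.step {P Q : MultiVec V} (h : LocalIso P Q) (s : V) : Step s P Q := by
  obtain ⟨A, hA, hPQ⟩ := h
  exact ⟨Unit, inferInstance, fun _ => A, fun _ => 1, by simpa using! hA s, fun _ v _ => hA v,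
    fun _ => by simpa using hPQ, by simp⟩

/-- All outcomes of the first step lead to the same vector up to a scalar, so the second instrument
of `s` need not wait for any message: `s` announces both outcomes together. Hence a node can
teleport any number of registers in one round. -/
theorem Step.trans {s : V} {P Q R : MultiVec V} (h : Step s P Q) (h' : Step s Q R) :
    Step s P R := by
  classical
  obtain ⟨I, _, A, c, h1, h2, h3, h4⟩ := h
  obtain ⟨J, _, B, b, h1', h2', h3', h4'⟩ := h'
  refine ⟨I × J, inferInstance, fun p v => B p.2 v * A p.1 v, fun p => c p.1 * b p.2, ?_,
    fun p v hv => (h2' _ v hv).mul (h2 _ v hv), fun p => ?_, ?_⟩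
  · rw [Fintype.sum_prod_type, ← h1]
    refine Finset.sum_congr rfl fun i _ => ?_
    have : ∀ j, (B j s * A i s)ᴴ * (B j s * A i s) =
        (A i s)ᴴ * ((B j s)ᴴ * B j s) * A i s := by
      intro j
      simp only [Matrix.conjTranspose_mul, Matrix.mul_assoc]
    simp only [this]
    rw [← Matrix.sum_mul, ← Matrix.mul_sum, h1', Matrix.mul_one]
  · rw [← localOp_mul, ← Matrix.mulVec_mulVec, h3, Matrix.mulVec_smul, h3', smul_smul]
  · rw [Fintype.sum_prod_type]
    simp only [norm_mul, mul_pow, ← Finset.mul_sum, h4', mul_one, h4]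

theorem LocalIso.of_equiv {P Q : MultiVec V} (e : (v : V) → P.ι v ≃ Q.ι v)
    (h : ∀ x, Q.vec (fun v => e v (x v)) = P.vec x) : LocalIso P Q := by
  classical
  refine ⟨fun v => monoOp (e v) fun _ => 1,
    fun v => isIsometry_monoOp (e v).injective fun _ => by simp, ?_⟩
  have hP : P.vec = ketSum P.vec fun x => x := by
    funext x
    simp only [ketSum]
    rw [Finset.sum_eq_single x]
    · rw [if_pos rfl]
    · exact fun y _ hy => if_neg hy.symm
    · simp
  rw [hP, localOp_monoOp_mulVec_ketSum]
  funext y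
  simp only [ketSum, Finset.prod_const_one, one_mul]
  have hy : y = fun v => e v ((e v).symm (y v)) := by simp
  rw [Finset.sum_eq_single fun v => (e v).symm (y v)]
  · rw [if_pos hy, ← h, ← hy]
  · intro x _ hx
    rw [if_neg]
    rintro rfl
    simp at hx
  · simp

theorem localIso_refl (P : MultiVec V) : LocalIso P P :=
  LocalIso.of_equiv (fun _ => Equiv.refl _) fun _ => rfl

theorem localIso_tensor_assoc (P Q R : MultiVec V) :
    LocalIso ((P.tensor Q).tensor R) (P.tensor (Q.tensor R)) :=
  LocalIso.of_equiv (fun _ => Equiv.prodAssoc _ _ _) fun _ => (mul_assoc _ _ _).symm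

theorem localIso_tensor_assoc_symm (P Q R : MultiVec V) :
    LocalIso (P.tensor (Q.tensor R)) ((P.tensor Q).tensor R) :=
  LocalIso.of_equiv (fun _ => (Equiv.prodAssoc _ _ _).symm) fun _ => mul_assoc _ _ _

theorem localIso_tensor_right_comm (P Q R : MultiVec V) :
    LocalIso ((P.tensor Q).tensor R) ((P.tensor R).tensor Q) :=
  LocalIso.of_equiv (fun _ => ⟨fun x => ((x.1.1, x.2), x.1.2), fun x => ((x.1.1, x.2), x.1.2),
    fun _ => rfl, fun _ => rfl⟩) fun _ => mul_right_comm _ _ _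

open Classical in
theorem localOp_kronecker_one_mulVec {P Q : MultiVec V} (A : (v : V) → Matrix (Q.ι v) (P.ι v) ℂ)
    (R : MultiVec V) :
    (localOp (ι := (P.tensor R).ι) (κ := (Q.tensor R).ι)
      fun v => A v ⊗ₖ (1 : Matrix (R.ι v) (R.ι v) ℂ)) *ᵥ (P.tensor R).vec =
      fun y => (localOp A *ᵥ P.vec) (fun v => (y v).1) * R.vec fun v => (y v).2 := by
  funext y
  let e : (((v : V) → P.ι v) × ((v : V) → R.ι v)) ≃ ((v : V) → (P.tensor R).ι v) :=
    ⟨fun p v => (p.1 v, p.2 v), fun x => (fun v => (x v).1, fun v => (x v).2), fun _ => rfl,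
      fun _ => rfl⟩
  simp only [Matrix.mulVec, dotProduct]
  rw [← e.sum_comp, Fintype.sum_prod_type, Finset.sum_mul]
  refine Finset.sum_congr rfl fun x _ => ?_
  rw [Finset.sum_eq_single fun v => (y v).2]
  · change (∏ v, A v (y v).1 (x v) * (1 : Matrix (R.ι v) (R.ι v) ℂ) (y v).2 (y v).2) *
      (P.vec x * R.vec fun v => (y v).2) = (∏ v, A v (y v).1 (x v)) * P.vec x * _
    simp [mul_assoc]
  · intro r _ hr
    obtain ⟨v, hv⟩ := Function.ne_iff.1 hr
    change (∏ v, A v (y v).1 (x v) * (1 : Matrix (R.ι v) (R.ι v) ℂ) (y v).2 (r v)) * _ = 0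
    rw [Finset.prod_eq_zero (Finset.mem_univ v), zero_mul]
    rw [Matrix.one_apply_ne hv.symm, mul_zero]
  · simp

theorem LocalIso.tensor {P Q : MultiVec V} (h : LocalIso P Q) (R : MultiVec V) :
    LocalIso (P.tensor R) (Q.tensor R) := by
  classical
  obtain ⟨A, hA, hPQ⟩ := h
  refine ⟨fun v => A v ⊗ₖ (1 : Matrix (R.ι v) (R.ι v) ℂ), fun v => (hA v).kronecker_one, ?_⟩
  refine (localOp_kronecker_one_mulVec A R).trans ?_
  rw [hPQ]
  rfl

theorem Step.tensor {s : V} {P Q : MultiVec V} (h : Step s P Q) (R : MultiVec V) :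
    Step s (P.tensor R) (Q.tensor R) := by
  classical
  obtain ⟨I, _, A, c, h1, h2, h3, h4⟩ := h
  refine ⟨I, inferInstance, fun i v => A i v ⊗ₖ (1 : Matrix (R.ι v) (R.ι v) ℂ), c, ?_,
    fun i v hv => (h2 i v hv).kronecker_one, fun i => ?_, h4⟩
  · ext x y
    have := congrFun (congrFun h1 x.1) y.1
    rw [Matrix.sum_apply] at this
    have hmul : ∀ i, (A i s ⊗ₖ (1 : Matrix (R.ι s) (R.ι s) ℂ))ᴴ *
        (A i s ⊗ₖ (1 : Matrix (R.ι s) (R.ι s) ℂ)) =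
        ((A i s)ᴴ * A i s) ⊗ₖ (1 : Matrix (R.ι s) (R.ι s) ℂ) := by
      intro i
      rw [Matrix.conjTranspose_kronecker, Matrix.conjTranspose_one, ← Matrix.mul_kronecker_mul,
        Matrix.mul_one]
    refine (Matrix.sum_apply _ _ _ _).trans ?_
    refine (Finset.sum_congr rfl fun i _ => congrFun (congrFun (hmul i) x) y).trans ?_
    refine (Finset.sum_mul _ _ _).symm.trans ?_
    rw [this]
    exact one_mul_one_apply_prod x y
  · refine (localOp_kronecker_one_mulVec (A i) R).trans ?_
    rw [h3]
    funext y
    exact mul_assoc _ _ _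

end Maps

end MultiVec

/-- These are the characters of the cyclic group of order `n`, with their orthogonality relations.
-/
theorem exists_fourier (n : ℕ) [NeZero n] : ∃ χ : Fin n → Fin n → ℂ,
    (∀ p x, ‖χ p x‖ = 1) ∧ ∀ x y, ∑ p, star (χ p x) * χ p y = if x = y then (n : ℂ) else 0 := by
  let e := ZMod.finEquiv n
  refine ⟨fun p x => ZMod.stdAddChar (e p * e x), fun p x => AddChar.norm_apply _ _, ?_⟩
  intro x y
  have h1 : ∀ p : Fin n, star (ZMod.stdAddChar (e p * e x)) * ZMod.stdAddChar (e p * e y) =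
      (ZMod.stdAddChar (e p * (e y - e x)) : ℂ) := by
    intro p
    rw [mul_sub, sub_eq_neg_add, AddChar.map_add_eq_mul, AddChar.map_neg_eq_conj]
    rfl
  simp only [h1]
  rw [show ∑ p, (ZMod.stdAddChar (e p * (e y - e x)) : ℂ) = _ from
      Equiv.sum_comp e.toEquiv fun q => (ZMod.stdAddChar (q * (e y - e x)) : ℂ),
    AddChar.sum_mulShift _ (ZMod.isPrimitive_stdAddChar n), ZMod.card]
  by_cases h : x = y
  · simp [h]
  · rw [if_neg h, if_neg, Nat.cast_zero]
    rw [sub_eq_zero, e.injective.eq_iff]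
    exact Ne.symm h

namespace MultiVec

/-! ### Access to the particle of one source -/

section Slots

variable {V : Type u} [DecidableEq V] (G : Network V) {T : Type} (e₀ : Finset V)

/-- The particle emitted by the source `e₀`. -/
def readSlot [Zero T] {v : V} (η : G.Incident v → T) : T :=
  if h : e₀ ∈ G.edges ∧ v ∈ e₀ then η ⟨e₀, h⟩ else 0

/-- Replaces the particle emitted by the source `e₀`. -/
def writeSlot {v : V} (η : G.Incident v → T) (t : T) : G.Incident v → T :=
  fun ε => if ε.1 = e₀ then t else η ε

variable {G e₀}

theorem readSlot_writeSlot [Zero T] (he₀ : e₀ ∈ G.edges) {v : V} (hv : v ∈ e₀) (η : G.Incident v → T)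
    (t : T) : readSlot G e₀ (writeSlot G e₀ η t) = t := by
  simp [readSlot, writeSlot, he₀, hv]

theorem writeSlot_writeSlot {v : V} (η : G.Incident v → T) (t t' : T) :
    writeSlot G e₀ (writeSlot G e₀ η t) t' = writeSlot G e₀ η t' := by
  funext ε
  simp only [writeSlot]
  split_ifs <;> rfl

theorem writeSlot_zero [Zero T] {v : V} : writeSlot G e₀ (0 : G.Incident v → T) 0 = 0 := by
  funext ε
  simp [writeSlot]

theorem ext_slot [Zero T] (he₀ : e₀ ∈ G.edges) {v : V} (hv : v ∈ e₀) {η θ : G.Incident v → T} {t t' : T}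
    (h : writeSlot G e₀ η t = writeSlot G e₀ θ t')
    (h' : readSlot G e₀ η = readSlot G e₀ θ) : η = θ := by
  funext ε
  by_cases hε : ε.1 = e₀
  · simp only [readSlot, he₀, hv, and_self, dite_true] at h'
    obtain ⟨ε, hε'⟩ := ε
    subst hε
    exact h'
  · have := congrFun h ε
    simpa [writeSlot, hε] using this

end Slots

/-! ### Teleportation -/

section Teleportation

variable {V : Type u} [Fintype V] [DecidableEq V]

open Classical in
-- `hs` is the completeness relation of the instrument at `s`, `hf` and `ha` make the corrections of
-- the other nodes isometric, and `hvec` says that every outcome gives the same vector up to a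
-- scalar.
theorem step_of_monoOp {s : V} {ι κ : V → Type u} [∀ v, Fintype (ι v)] [∀ v, Fintype (κ v)]
    {Z Z' : Type*} [Fintype Z] [Fintype Z'] {ψ : Z → ℂ} {β : Z → (v : V) → ι v} {ψ' : Z' → ℂ}
    {β' : Z' → (v : V) → κ v} {I : Type} [Fintype I]
    (f : I → (v : V) → ι v → κ v) (a : I → (v : V) → ι v → ℂ) (c : I → ℂ)
    (hs : ∀ x y, (∑ i, if f i s x = f i s y then star (a i s x) * a i s y else 0) =
      if x = y then 1 else 0)
    (hf : ∀ i, ∀ v ≠ s, Function.Injective (f i v)) (ha : ∀ i, ∀ v ≠ s, ∀ x, ‖a i v x‖ = 1)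
    (hvec : ∀ i, ketSum (fun z => (∏ v, a i v (β z v)) * ψ z) (fun z v => f i v (β z v)) =
      c i • ketSum ψ' β')
    (hc : ∑ i, ‖c i‖ ^ 2 = 1) : Step s (super ι ψ β) (super κ ψ' β') := by
  refine ⟨I, inferInstance, fun i v => monoOp (f i v) (a i v), c, ?_,
    fun i v hv => isIsometry_monoOp (hf i v hv) (ha i v hv), fun i => ?_, hc⟩
  · ext x y
    refine (Matrix.sum_apply _ _ _ _).trans ?_
    refine Eq.trans (Finset.sum_congr rfl fun i _ => ?_) (hs x y)
    exact monoOp_conjTranspose_mul_monoOp (f i s) (a i s) x y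
  · exact (localOp_monoOp_mulVec_ketSum (f i) (a i) ψ β).trans (hvec i)

variable (G : Network V) (T : Type) [Zero T] [Fintype T] (e₀ : Finset V)

/-- A maximally entangled pair distributed to `s` and `b` by the source `e₀`; all other particles
are in a fixed basis state. -/
def epr (s b : V) : MultiVec V :=
  super (fun v => G.Incident v → T) (fun _ : T => (((√(Fintype.card T))⁻¹ : ℝ) : ℂ))
    fun t v => if v = s ∨ v = b then writeSlot G e₀ 0 t else 0

variable {G e₀}

theorem sum_norm_sq_const (T : Type*) [Fintype T] [Nonempty T] :
    ∑ _ : T, ‖(((√(Fintype.card T))⁻¹ : ℝ) : ℂ)‖ ^ 2 = 1 := by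
  simp only [Complex.norm_real, norm_inv, inv_pow, Finset.sum_const, Finset.card_univ,
    nsmul_eq_mul, Real.norm_eq_abs, sq_abs, Nat.cast_nonneg, Real.sq_sqrt]
  exact mul_inv_cancel₀ (Nat.cast_ne_zero.2 Fintype.card_ne_zero)

variable {d : V → ℕ} [∀ v, NeZero (d v)] {Z : Type*} [Fintype Z]

/-- With an entangled pair and one round of communication by `s`, the register `w` of `s` is
coherently copied to `b`. -/
theorem step_copy (he₀ : e₀ ∈ G.edges) {s b : V} (hs : s ∈ e₀) (hb : b ∈ e₀) (hsb : s ≠ b) (w : V)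
    (ψ : Z → ℂ) (β : Z → V → Idx d) (hβ : ∀ z, β z b w = 0) :
    Step s ((super (fun _ => Idx d) ψ β).tensor (epr G (Fin (d w)) e₀ s b))
      ((super (fun _ => Idx d) ψ fun z v =>
        if v = b then Function.update (β z b) w (β z s w) else β z v).tensor
        (basis (fun v => G.Incident v → Fin (d w)) 0)) := by
  classical
  rw [epr, super_tensor_super, super_tensor_basis]
  refine step_of_monoOp (I := Fin (d w))
    -- Node `s` measures the difference `q` between its half of the pair and its register, and
    -- resets its half. Node `b` subtracts `q` from its half, which yields the value of the
    -- register, and swaps the result into its own register. The swap keeps the map injective and,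
    -- as that register was zero, resets the half of `b`.
    (fun q v x => if v = s then (x.1, writeSlot G e₀ x.2 0) else if v = b then
      (Function.update x.1 w (readSlot G e₀ x.2 - q), writeSlot G e₀ x.2 (x.1 w)) else x)
    (fun q v x => if v = s then if readSlot G e₀ x.2 - x.1 w = q then 1 else 0 else 1)
    (fun _ => (((√(Fintype.card (Fin (d w))))⁻¹ : ℝ) : ℂ)) ?_ ?_ ?_ ?_ (sum_norm_sq_const _)
  · rintro ⟨x, η⟩ ⟨y, θ⟩
    simp only [if_true]
    by_cases h : (x, η) = (y, θ)
    · obtain ⟨rfl, rfl⟩ := Prod.mk.inj h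
      simp
    · rw [if_neg h]
      refine Finset.sum_eq_zero fun q _ => ?_
      split_ifs with h1 h2 h3 <;> try simp
      obtain ⟨rfl, h5⟩ := Prod.mk.inj h1
      refine h (Prod.ext rfl (ext_slot he₀ hs h5 ?_))
      exact sub_left_injective (h2.trans h3.symm)
  · intro q v hv
    simp only [if_neg hv]
    split_ifs with h
    · subst h
      rintro ⟨x, η⟩ ⟨y, θ⟩ hxy
      obtain ⟨h1, h2⟩ := Prod.mk.inj hxy
      dsimp only at h1 h2
      have h3 : x w = y w := by
        have := congrArg (readSlot G e₀) h2
        rwa [readSlot_writeSlot he₀ hb, readSlot_writeSlot he₀ hb] at this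
      have h4 : readSlot G e₀ η = readSlot G e₀ θ := by
        have := congrFun h1 w
        rw [Function.update_self, Function.update_self] at this
        exact sub_left_injective this
      refine Prod.ext ?_ (ext_slot he₀ hb h2 h4)
      funext r
      by_cases hr : r = w
      · subst hr; exact h3
      · have := congrFun h1 r
        rwa [Function.update_of_ne hr, Function.update_of_ne hr] at this
    · exact fun _ _ h => h
  · intro q v hv x
    simp [hv]
  · intro q
    funext y
    simp only [ketSum, Pi.smul_apply, smul_eq_mul, Finset.mul_sum, Fintype.sum_prod_type]
    refine Finset.sum_congr rfl fun z _ => ?_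
    -- The outcome `q` selects one term of the entangled pair.
    rw [Finset.sum_eq_single (q + β z s w)]
    · have h1 : (∏ v, if v = s then if readSlot G e₀ (if v = s ∨ v = b then
          writeSlot G e₀ (0 : G.Incident v → Fin (d w)) (q + β z s w) else 0) - β z v w = q
          then (1 : ℂ) else 0 else 1) = 1 := by
        refine Finset.prod_eq_one fun v _ => ?_
        by_cases hv : v = s
        · subst hv
          simp [readSlot_writeSlot he₀ hs]
        · rw [if_neg hv]
      have h2 : (fun v => if v = s then (β z v, writeSlot G e₀ (if v = s ∨ v = b then
          writeSlot G e₀ (0 : G.Incident v → Fin (d w)) (q + β z s w) else 0) 0)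
          else if v = b then (Function.update (β z v) w (readSlot G e₀ (if v = s ∨ v = b then
            writeSlot G e₀ (0 : G.Incident v → Fin (d w)) (q + β z s w) else 0) - q),
              writeSlot G e₀ (if v = s ∨ v = b then
            writeSlot G e₀ (0 : G.Incident v → Fin (d w)) (q + β z s w) else 0) (β z v w))
          else (β z v, if v = s ∨ v = b then
            writeSlot G e₀ (0 : G.Incident v → Fin (d w)) (q + β z s w) else 0)) =
          fun v => (if v = b then Function.update (β z b) w (β z s w) else β z v,
            (0 : (v : V) → G.Incident v → Fin (d w)) v) := by
        funext v
        by_cases hv : v = s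
        · subst hv
          simp [hsb, writeSlot_writeSlot, writeSlot_zero]
        · by_cases hv' : v = b
          · subst hv'
            simp [hv, writeSlot_writeSlot, readSlot_writeSlot he₀ hb, hβ, writeSlot_zero]
          · simp [hv, hv']
      simp only [h1, h2, one_mul]
      split_ifs <;> simp [mul_comm]
    · intro t _ ht
      rw [Finset.prod_eq_zero (Finset.mem_univ s), zero_mul, ite_self]
      rw [if_pos rfl, if_pos (Or.inl rfl), readSlot_writeSlot he₀ hs, if_neg]
      rintro rfl
      exact ht (by simp)
    · simp

/-- With one round of communication by `s`, the register `w` of `s`, a copy of that of `b`, is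
reset. -/
theorem step_erase {s b : V} (hsb : s ≠ b) (w : V) (ψ : Z → ℂ) (β : Z → V → Idx d)
    (hβ : ∀ z, β z s w = β z b w) :
    Step s (super (fun _ => Idx d) ψ β) (super (fun _ => Idx d) ψ fun z v =>
      if v = s then Function.update (β z s) w 0 else β z v) := by
  classical
  obtain ⟨χ, hχ, hsum⟩ := exists_fourier (d w)
  set c : ℂ := (((√(Fintype.card (Fin (d w))))⁻¹ : ℝ) : ℂ) with hc
  have hcc : star c * c * d w = 1 := by
    have h1 : (0 : ℝ) < d w := Nat.cast_pos.2 (Nat.pos_of_ne_zero (NeZero.ne _))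
    have h2 : (√(d w : ℝ))⁻¹ * (√(d w : ℝ))⁻¹ * d w = 1 := by
      rw [← mul_inv, Real.mul_self_sqrt h1.le, inv_mul_cancel₀ h1.ne']
    simp only [hc, Fintype.card_fin, Complex.star_def, Complex.conj_ofReal]
    exact_mod_cast h2
  refine step_of_monoOp (I := Fin (d w))
    (fun _ v x => if v = s then Function.update x w 0 else x)
    -- Node `s` measures its register in the Fourier basis. Outcome `p` leaves a phase, which `b`
    -- undoes with the conjugate phase of its identical copy.
    (fun p v x => if v = s then c * star (χ p (x w)) else if v = b then χ p (x w) else 1)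
    (fun _ => c) ?_ ?_ ?_ ?_ (sum_norm_sq_const _)
  · intro x y
    simp only [if_true]
    by_cases h : Function.update x w 0 = Function.update y w 0
    · have h1 : ∀ p, star (c * star (χ p (x w))) * (c * star (χ p (y w))) =
          star c * c * (star (χ p (y w)) * χ p (x w)) := by
        intro p
        rw [star_mul', star_star]
        ring
      simp only [h, if_true, h1]
      rw [← Finset.mul_sum, hsum]
      by_cases hxy : x w = y w
      · have : x = y := by
          funext r
          by_cases hr : r = w
          · subst hr; exact hxy
          · simpa [hr] using congrFun h r
        rw [if_pos this, if_pos hxy.symm, hcc]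
      · rw [if_neg (Ne.symm hxy), if_neg fun h => hxy (congrFun h w), mul_zero]
    · rw [if_neg fun hxy => h (by rw [hxy])]
      simp [h]
  · intro p v hv
    simp only [if_neg hv]
    exact fun _ _ h => h
  · intro p v hv x
    simp only [if_neg hv]
    split_ifs
    · exact hχ _ _
    · simp
  · intro p
    funext y
    simp only [ketSum, Pi.smul_apply, smul_eq_mul, Finset.mul_sum]
    refine Finset.sum_congr rfl fun z _ => ?_
    have h1 : (∏ v, if v = s then c * star (χ p (β z v w)) else
        if v = b then χ p (β z v w) else 1) = c := by
      rw [Fintype.prod_eq_mul s b hsb fun v hv => by rw [if_neg hv.1, if_neg hv.2], if_pos rfl,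
        if_neg hsb.symm, if_pos rfl, hβ, mul_assoc]
      have := RCLike.conj_mul (χ p (β z b w))
      rw [hχ] at this
      rw [Complex.star_def, this]
      simp
    have h2 : (fun v => if v = s then Function.update (β z v) w 0 else β z v) =
        fun v => if v = s then Function.update (β z s) w 0 else β z v := by
      funext v
      split_ifs with h
      · rw [h]
      · rfl
    rw [h1, h2]
    split_ifs <;> simp

/-- Teleportation of the register `w` from `s` to `b`. -/
theorem step_teleport (he₀ : e₀ ∈ G.edges) {s b : V} (hs : s ∈ e₀) (hb : b ∈ e₀) (hsb : s ≠ b)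
    (w : V) (ψ : Z → ℂ) (β : Z → V → Idx d) (hβ : ∀ z, β z b w = 0) :
    Step s ((super (fun _ => Idx d) ψ β).tensor (epr G (Fin (d w)) e₀ s b))
      ((super (fun _ => Idx d) ψ fun z v => if v = s then Function.update (β z s) w 0 else
        if v = b then Function.update (β z b) w (β z s w) else β z v).tensor
        (basis (fun v => G.Incident v → Fin (d w)) 0)) := by
  -- Teleportation is a coherent copy followed by erasure of the original; in both, only `s`
  -- communicates.
  refine (step_copy he₀ hs hb hsb w ψ β hβ).trans ?_
  have h := (step_erase hsb w ψ (fun z v =>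
    if v = b then Function.update (β z b) w (β z s w) else β z v)
    fun z => by simp [hsb]).tensor (basis (fun v => G.Incident v → Fin (d w)) 0)
  simpa only [hsb, if_false] using h

end Teleportation

end MultiVec

theorem sum_norm_sq_ketSum {α Z : Type*} [Fintype α] [Fintype Z] (ψ : Z → ℂ) {β : Z → α}
    (hβ : Function.Injective β) : ∑ x, ‖ketSum ψ β x‖ ^ 2 = ∑ z, ‖ψ z‖ ^ 2 := by
  classical
  symm
  refine Fintype.sum_of_injective β hβ _ _ (fun x hx => ?_) fun z => ?_
  · have : ketSum ψ β x = 0 := Finset.sum_eq_zero fun z _ => if_neg fun h => hx ⟨z, h.symm⟩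
    rw [this]
    simp
  · have : ketSum ψ β (β z) = ψ z := by
      unfold ketSum
      rw [Finset.sum_eq_single z]
      · rw [if_pos rfl]
      · exact fun y _ hy => if_neg fun h => hy (hβ h).symm
      · simp
    rw [this]

namespace MultiVec

/-! ### Vectors emitted by the sources -/

section Net

variable {V : Type u} [DecidableEq V]

/-- `P` is a tensor product of unit vectors emitted by the sources of the network. -/
def IsNet (G : Network V) (P : MultiVec V) : Prop :=
  ∃ (D : Finset V → V → Type) (_ : ∀ e v, Fintype (D e v))
    (φ : (v : V) → P.ι v ≃ ((e : G.Incident v) → D e.1 v))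
    (g : (e : Finset V) → ((v : {v // v ∈ e}) → D e v.1) → ℂ),
    (∀ e ∈ G.edges, ∑ x, ‖g e x‖ ^ 2 = 1) ∧
    ∀ x, P.vec x = ∏ e : {e // e ∈ G.edges}, g e.1 fun v => φ v.1 (x v.1) ⟨e.1, e.2, v.2⟩

variable {G : Network V}

theorem IsNet.tensor {P Q : MultiVec V} (hP : IsNet G P) (hQ : IsNet G Q) :
    IsNet G (P.tensor Q) := by
  obtain ⟨D, _, φ, g, hg, hP⟩ := hP
  obtain ⟨D', _, φ', g', hg', hQ⟩ := hQ
  refine ⟨fun e v => D e v × D' e v, inferInstance,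
    fun v => ⟨fun x e => (φ v x.1 e, φ' v x.2 e),
      fun y => ((φ v).symm fun e => (y e).1, (φ' v).symm fun e => (y e).2),
      fun x => Prod.ext (by simp) (by simp), fun y => by simp⟩,
    fun e x => g e (fun v => (x v).1) * g' e fun v => (x v).2, fun e he => ?_, fun x => ?_⟩
  · let eq : (((v : {v // v ∈ e}) → D e v.1) × ((v : {v // v ∈ e}) → D' e v.1)) ≃
        ((v : {v // v ∈ e}) → D e v.1 × D' e v.1) :=
      ⟨fun p v => (p.1 v, p.2 v), fun x => (fun v => (x v).1, fun v => (x v).2), fun _ => rfl,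
        fun _ => rfl⟩
    rw [← eq.sum_comp, Fintype.sum_prod_type]
    simp only [norm_mul, mul_pow, eq, Equiv.coe_fn_mk, ← Finset.mul_sum, hg' e he, mul_one,
      hg e he]
  · simp only [MultiVec.tensor, hP, hQ, Finset.prod_mul_distrib]
    rfl

theorem isNet_unit : IsNet G (unit V) := by
  classical
  refine ⟨fun _ _ => PUnit, inferInstance, fun v => Equiv.ofUnique PUnit _, fun _ _ => 1,
    fun e _ => by simp, fun x => ?_⟩
  simp only [unit, basis, super, ketSum, Finset.prod_const_one, Finset.sum_const,
    Finset.card_univ, Fintype.card_unit, one_smul]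
  exact if_pos (funext fun _ => rfl)

end Net

variable {V : Type u} [Fintype V] [DecidableEq V] {G : Network V}

/-- The source `e₀` emits the pair, with zeros for its other nodes; all other sources emit the zero
basis vector. Membership of `s` in `e₀` makes the basis vectors of the pair distinct, hence the
emitted vector normalized. -/
theorem isNet_epr {e₀ : Finset V} (he₀ : e₀ ∈ G.edges) {s b : V} (hs : s ∈ e₀)
    (n : ℕ) [NeZero n] : IsNet G (epr G (Fin n) e₀ s b) := by
  classical
  let β : (e : Finset V) → Fin n → (v : {v // v ∈ e}) → Fin n := fun e t v =>
    if v.1 = s ∨ v.1 = b then t else 0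
  let g : (e : Finset V) → ((v : {v // v ∈ e}) → Fin n) → ℂ := fun e =>
    if e = e₀ then ketSum (fun _ : Fin n => (((√(Fintype.card (Fin n)))⁻¹ : ℝ) : ℂ)) (β e)
    else ketSum (fun _ : Unit => 1) fun _ => 0
  refine ⟨fun _ _ => Fin n, inferInstance, fun v => Equiv.refl _, g, fun e he => ?_, fun x => ?_⟩
  · by_cases h : e = e₀
    · subst h
      simp only [g, if_true]
      rw [sum_norm_sq_ketSum, sum_norm_sq_const]
      intro t t' htt
      simpa [β] using congrFun htt ⟨s, hs⟩
    · simp only [g, if_neg h]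
      rw [sum_norm_sq_ketSum]
      · simp
      · exact Function.injective_of_subsingleton _
  · let r : (e : {e // e ∈ G.edges}) → (v : {v // v ∈ e.1}) → Fin n := fun e v =>
      x v.1 ⟨e.1, e.2, v.2⟩
    change ketSum (fun _ : Fin n => (((√(Fintype.card (Fin n)))⁻¹ : ℝ) : ℂ))
      (fun t v => if v = s ∨ v = b then writeSlot G e₀ 0 t else 0) x = ∏ e : {e // e ∈ G.edges}, g e.1 (r e)
    by_cases hr : ∀ e : {e // e ∈ G.edges}, e.1 ≠ e₀ → r e = 0
    · rw [Fintype.prod_eq_single ⟨e₀, he₀⟩]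
      · simp only [g, if_true, ketSum]
        refine Finset.sum_congr rfl fun t _ => ?_
        refine if_congr ?_ rfl rfl
        constructor
        · rintro rfl
          funext v
          simp only [r, β]
          split_ifs <;> simp [writeSlot]
        · intro h
          funext v ε
          by_cases hε : ε.1 = e₀
          · obtain ⟨ε, hε', hvε⟩ := ε
            subst hε
            have := congrFun h ⟨v, hvε⟩
            simp only [r, β] at this
            rw [this]
            split_ifs <;> simp [writeSlot]
          · have : x v ε = 0 := congrFun (hr ⟨ε.1, ε.2.1⟩ hε) ⟨v, ε.2.2⟩
            rw [this]
            split_ifs <;> simp [writeSlot, hε]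
      · intro e he
        have he' : e.1 ≠ e₀ := fun h => he (Subtype.ext h)
        simp only [g, if_neg he', hr e he', ketSum]
        simp
    · push Not at hr
      obtain ⟨e, he, hre⟩ := hr
      rw [Finset.prod_eq_zero (Finset.mem_univ e)]
      · refine Finset.sum_eq_zero fun t _ => if_neg ?_
        rintro rfl
        refine hre ?_
        funext v
        simp only [r]
        split_ifs <;> simp [writeSlot, he]
      · simp only [g, if_neg he, ketSum, if_neg hre, Finset.sum_const_zero]

/-- `Q` is obtained from `P` and particles from the sources by one round of communication by `s`;
registers in fixed basis states may be left over. -/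
def AssistedStep (G : Network V) (s : V) (P Q : MultiVec V) : Prop :=
  ∃ (R : MultiVec V) (κ : V → Type u) (_ : ∀ v, Fintype (κ v)) (g : (v : V) → κ v),
    IsNet G R ∧ Step s (P.tensor R) (Q.tensor (basis κ g))

theorem assistedStep_refl (s : V) (P : MultiVec V) : AssistedStep G s P P :=
  ⟨unit V, _, _, _, isNet_unit, (localIso_refl _).step s⟩

theorem AssistedStep.trans {s : V} {P Q R : MultiVec V} (h : AssistedStep G s P Q)
    (h' : AssistedStep G s Q R) : AssistedStep G s P R := by
  obtain ⟨N, κ, _, g, hN, h⟩ := h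
  obtain ⟨N', κ', _, g', hN', h'⟩ := h'
  refine ⟨N.tensor N', fun v => κ' v × κ v, inferInstance, fun v => (g' v, g v),
    hN.tensor hN', ?_⟩
  rw [← basis_tensor_basis]
  exact (((((localIso_tensor_assoc_symm _ _ _).step s).trans (h.tensor N')).trans
    ((localIso_tensor_right_comm _ _ _).step s)).trans (h'.tensor (basis κ g))).trans
    ((localIso_tensor_assoc _ _ _).step s)

/-! ### Moving the systems of the target state -/

section Placement

variable {d : V → ℕ} [∀ v, NeZero (d v)]

/-- The basis vector in which the register `w` of the node `loc w` contains `z w`; all other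
registers are in the state zero. -/
def place (loc : V → V) (z : Idx d) (v : V) : Idx d := fun w => if loc w = v then z w else 0

/-- The vector `ψ`, the system `w` of which is at the node `loc w`. -/
def located (ψ : Idx d → ℂ) (loc : V → V) : MultiVec V :=
  super (fun _ => Idx d) ψ (place loc)

theorem assistedStep_update (ψ : Idx d → ℂ) {s b w : V} {loc : V → V} (hloc : loc w = s)
    (hadj : G.graph.Adj s b) :
    AssistedStep G s (located ψ loc) (located ψ (Function.update loc w b)) := by
  obtain ⟨hsb, e₀, he₀, hs, hb⟩ := hadj
  refine ⟨epr G (Fin (d w)) e₀ s b, fun v => G.Incident v → Fin (d w), inferInstance, 0,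
    isNet_epr he₀ hs _, ?_⟩
  have h := step_teleport he₀ hs hb hsb w ψ (place loc) fun z => by simp [place, hloc, hsb]
  refine Eq.mp (congrArg (fun β => Step s _ ((super (fun _ => Idx d) ψ β).tensor _)) ?_) h
  funext z v r
  by_cases hr : r = w
  · subst hr
    by_cases hv : v = s
    · subst hv
      simp [place, hsb.symm]
    · by_cases hv' : v = b
      · subst hv'
        simp [place, hv, hloc]
      · simp [place, hv, hv', hloc, Ne.symm hv, Ne.symm hv']
  · by_cases hv : v = s
    · subst hv
      simp [place, hr]
    · by_cases hv' : v = b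
      · subst hv'
        simp [place, hv, hr]
      · simp [place, hv, hv', hr]

theorem assistedStep_located (ψ : Idx d → ℂ) {s : V} {loc loc' : V → V}
    (h : ∀ w, loc' w = loc w ∨ loc w = s ∧ G.graph.Adj s (loc' w)) :
    AssistedStep G s (located ψ loc) (located ψ loc') := by
  -- `M` is the set of systems already moved; composing the moves stays within one round of `s`.
  have key : ∀ M : Finset V,
      AssistedStep G s (located ψ loc) (located ψ (M.piecewise loc' loc)) := by
    intro M
    induction M using Finset.induction_on with
    | empty => simpa using assistedStep_refl s (located ψ loc)
    | insert w M hw ih =>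
      rw [Finset.piecewise_insert]
      have hw' : M.piecewise loc' loc w = loc w := Finset.piecewise_eq_of_notMem _ _ _ hw
      rcases h w with h | ⟨hs, hadj⟩
      · rwa [h, ← hw', Function.update_eq_self]
      · exact ih.trans (assistedStep_update ψ (hw'.trans hs) hadj)
  simpa using key Finset.univ

end Placement

/-- `Q` is obtained from `P` by `k` rounds of communication. -/
inductive Chain : ℕ → MultiVec V → MultiVec V → Prop
  | iso {P Q : MultiVec V} (h : LocalIso P Q) : Chain 0 P Q
  | step {k : ℕ} {P Q R : MultiVec V} (h : Chain k P Q) (s : V) (h' : Step s Q R) :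
      Chain (k + 1) P R

theorem Chain.tensor {k : ℕ} {P Q : MultiVec V} (h : Chain k P Q) (R : MultiVec V) :
    Chain k (P.tensor R) (Q.tensor R) := by
  induction h with
  | iso h => exact .iso (h.tensor R)
  | step _ s h' ih => exact .step ih s (h'.tensor R)

/-! ### Spreading the target state along a connected dominating set -/

section Coverage

variable {d : V → ℕ} [∀ v, NeZero (d v)]

/-- With `k` rounds, the systems of `ψ` can be distributed arbitrarily to the nodes in `U`. -/
def Covers (G : Network V) (ψ : Idx d → ℂ) (k : ℕ) (U : Set V) : Prop :=
  ∀ loc : V → V, (∀ w, loc w ∈ U) →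
    ∃ (R : MultiVec V) (κ : V → Type u) (_ : ∀ v, Fintype (κ v)) (g : (v : V) → κ v),
      IsNet G R ∧ Chain k R ((located ψ loc).tensor (basis κ g))

/-- Node `s` prepares all of `ψ` locally and the others prepare zero registers, so no source is
needed. -/
theorem covers_singleton {ψ : Idx d → ℂ} (hψ : star ψ ⬝ᵥ ψ = 1) (s : V) :
    Covers G ψ 0 {s} := by
  classical
  intro loc hloc
  refine ⟨unit V, fun _ => PUnit, inferInstance, fun _ => PUnit.unit, isNet_unit, .iso ?_⟩
  let φ : V → Idx d × PUnit.{u + 1} → ℂ := fun v x =>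
    if v = s then ψ x.1 else if x.1 = 0 then 1 else 0
  let A : V → Matrix (Idx d × PUnit.{u + 1}) PUnit.{u + 1} ℂ := fun v =>
    Matrix.of fun x _ => φ v x
  have hφ_self : ∀ x, φ s x = ψ x.1 := fun x => if_pos rfl
  have hφ_zero : ∀ v ≠ s, ∀ x : Idx d × PUnit, x.1 = 0 → φ v x = 1 := fun v hv x hx => by
    simp [φ, hv, hx]
  have hφ_ne : ∀ v ≠ s, ∀ x : Idx d × PUnit, x.1 ≠ 0 → φ v x = 0 := fun v hv x hx => by
    simp [φ, hv, hx]
  have hA : ∀ v, IsIsometry (A v) := by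
    intro v
    refine isIsometry_of_column (fun _ _ => rfl) ?_
    rw [dotProduct, Fintype.sum_prod_type]
    by_cases hv : v = s
    · subst hv
      simpa [hφ_self, dotProduct] using hψ
    · rw [Finset.sum_eq_single (0 : Idx d)]
      · simp [hφ_zero v hv]
      · intro x _ hx
        simp [hφ_ne v hv (x, _) hx]
      · simp
  refine ⟨A, hA, ?_⟩
  have hplace : ∀ z v, place loc z v = if v = s then z else (0 : Idx d) := by
    intro z v
    funext w
    have : loc w = s := hloc w
    by_cases hv : v = s
    · simp [place, this, hv]
    · simp [place, this, hv, Ne.symm hv]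
  refine (mulVec_ketSum _ _ _).trans ?_
  refine funext fun y : (v : V) → Idx d × PUnit.{u + 1} => ?_
  refine Eq.trans ?_ (super_tensor_basis_vec ψ (place loc) _ y).symm
  rw [Fintype.sum_unique, mul_one]
  change (∏ v, φ v (y v)) = ketSum ψ (fun z v => (place loc z v, PUnit.unit)) y
  by_cases hy : ∀ v ≠ s, (y v).1 = (0 : Idx d)
  · rw [Fintype.prod_eq_single s fun v hv => hφ_zero v hv _ (hy v hv), hφ_self]
    unfold ketSum
    rw [Finset.sum_eq_single (y s).1]
    · rw [if_pos]
      funext v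
      refine Prod.ext ?_ rfl
      by_cases hv : v = s
      · subst hv
        simp [hplace]
      · simp [hplace, hv, hy v hv]
    · intro z _ hz
      rw [if_neg]
      rintro rfl
      simp [hplace] at hz
    · simp
  · push Not at hy
    obtain ⟨v, hv, hyv⟩ := hy
    rw [Finset.prod_eq_zero (Finset.mem_univ v) (hφ_ne v hv _ hyv)]
    symm
    refine Finset.sum_eq_zero fun z _ => if_neg ?_
    rintro rfl
    exact hyv ((hplace z v).trans (if_neg hv))

/-- Systems destined for nodes outside of `U` are first placed at `s`, which then teleports them to
their destinations. -/
theorem Covers.step {ψ : Idx d → ℂ} {k : ℕ} {U : Set V} (h : Covers G ψ k U) {s : V}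
    (hs : s ∈ U) : Covers G ψ (k + 1) (U ∪ {v | G.graph.Adj s v}) := by
  classical
  intro loc hloc
  obtain ⟨R, κ, _, g, hR, hchain⟩ := h (fun w => if loc w ∈ U then loc w else s) fun w => by
    split_ifs with hw
    · exact hw
    · exact hs
  obtain ⟨N, κ', _, g', hN, hstep⟩ := assistedStep_located (G := G) ψ (s := s)
    (loc := fun w => if loc w ∈ U then loc w else s) (loc' := loc) fun w => by
      by_cases hw : loc w ∈ U
      · exact Or.inl (if_pos hw).symm
      · exact Or.inr ⟨if_neg hw, (hloc w).resolve_left hw⟩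
  refine ⟨R.tensor N, fun v => κ' v × κ v, inferInstance, fun v => (g' v, g v), hR.tensor hN,
    .step (hchain.tensor N) s ?_⟩
  rw [← basis_tensor_basis]
  exact (((localIso_tensor_right_comm _ _ _).step s).trans (hstep.tensor (basis κ g))).trans
    ((localIso_tensor_assoc _ _ _).step s)

theorem covers_univ {ψ : Idx d → ℂ} (hψ : star ψ ⬝ᵥ ψ = 1) {S : Finset V}
    (hS : G.IsConnectedDominating S) : Covers G ψ S.card Set.univ := by
  classical
  obtain ⟨hconn, hdom⟩ := hS
  obtain ⟨⟨s₁, hs₁⟩⟩ := hconn.nonempty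
  rw [Finset.mem_coe] at hs₁
  -- `A` consists of the nodes that have had their round; the shift by one accounts for `s₁`, which
  -- communicates first.
  have key : ∀ j < S.card, ∃ A ⊆ S, s₁ ∈ A ∧ A.card = j + 1 ∧
      Covers G ψ (j + 1) {v | v ∈ A ∨ ∃ s ∈ A, G.graph.Adj s v} := by
    intro j
    induction j with
    | zero =>
      intro _
      refine ⟨{s₁}, by simpa using hs₁, by simp, by simp, ?_⟩
      convert (covers_singleton (G := G) hψ s₁).step rfl using 1
      ext v
      simp
    | succ j ih =>
      intro hj
      obtain ⟨A, hAS, hsA, hcard, hcov⟩ := ih (by omega)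
      obtain ⟨t, htS, htA⟩ : ∃ t ∈ S, t ∉ A := by
        by_contra! hcon
        have := Finset.card_le_card (show S ⊆ A from hcon)
        omega
      obtain ⟨p⟩ := hconn.preconnected ⟨s₁, hs₁⟩ ⟨t, htS⟩
      -- A walk in `S` that leaves `A` has a first endpoint outside of `A` next to `A`: a node
      -- already reached, which can take the next round.
      obtain ⟨e, -, he1, he2⟩ := p.exists_boundary_dart {x | x.1 ∈ A} hsA htA
      have hadj : G.graph.Adj e.fst.1 e.snd.1 := by simpa using e.adj
      refine ⟨insert e.snd.1 A, Finset.insert_subset e.snd.2 hAS, by simp [hsA], ?_, ?_⟩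
      · rw [Finset.card_insert_of_notMem he2, hcard]
      · convert hcov.step (s := e.snd.1) (Or.inr ⟨_, he1, hadj⟩) using 1
        ext v
        simp only [Finset.mem_insert, exists_eq_or_imp, Set.mem_union, Set.mem_ofPred_eq]
        constructor
        · rintro ((rfl | h) | h | h)
          · exact Or.inl (Or.inr ⟨_, he1, hadj⟩)
          · exact Or.inl (Or.inl h)
          · exact Or.inr h
          · exact Or.inl (Or.inr h)
        · rintro ((h | h) | h)
          · exact Or.inl (Or.inr h)
          · exact Or.inr (Or.inr h)
          · exact Or.inr (Or.inl h)
  have hpos : 0 < S.card := Finset.card_pos.2 ⟨s₁, hs₁⟩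
  obtain ⟨A, hAS, -, hcard, hcov⟩ := key (S.card - 1) (by omega)
  have hA : A = S := Finset.eq_of_subset_of_card_le hAS (by omega)
  rw [hA, Nat.sub_add_cancel hpos] at hcov
  exact fun loc _ => hcov loc fun w => hdom (loc w)

end Coverage

end MultiVec

/-! ### Realization as LOCC protocols -/

section Protocols

variable {V : Type*} [Fintype V] [DecidableEq V]

theorem productMap_smul {n m : V → ℕ} (K : (v : V) → Kraus (n v) (m v)) (c : ℝ) (τ : Op n) :
    productMap K (c • τ) = c • productMap K τ := by
  simp [productMap, Finset.smul_sum]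

theorem IsLOCC.map_smul {k : ℕ} {n m : V → ℕ} {Λ : Op n → Op m} (h : IsLOCC k n m Λ) (c : ℝ)
    (τ : Op n) : Λ (c • τ) = c • Λ τ := by
  obtain ⟨I, _, K, S, -, -, hsum⟩ := h.exists_branches
  simp only [hsum, productMap_smul, Finset.smul_sum]

/-- Preliminary local channels are absorbed into the first local operations and cost no round. -/
theorem IsLOCC.comp_productMap {k : ℕ} {n l m : V → ℕ} {Λ : Op l → Op m} (h : IsLOCC k l m Λ)
    (K : (v : V) → Kraus (n v) (l v)) (hK : ∀ v, (K v).IsChannel) :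
    IsLOCC k n m fun τ => Λ (productMap K τ) := by
  cases h with
  | localOps K' hK' =>
    simp only [productMap_comp]
    exact .localOps _ fun v => (hK' v).comp (hK v)
  | round v N l' K' hv hu Λ' hΛ =>
    simp only [productMap_comp]
    refine .round v N l' _ ?_ (fun i u hu' => (hu i u hu').comp (hK u)) Λ' hΛ
    simp only [Kraus.gram_comp]
    rw [Finset.sum_comm]
    simp only [← Matrix.sum_mul, ← Matrix.mul_sum, hv, Matrix.mul_one]
    exact hK v

/-- The map `X ↦ A X Aᴴ`. -/
def Kraus.single {n m : ℕ} (A : Matrix (Fin m) (Fin n) ℂ) : Kraus n m := ⟨1, fun _ => A⟩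

theorem Kraus.gram_single {n m : ℕ} (A : Matrix (Fin m) (Fin n) ℂ) :
    (Kraus.single A).gram = Aᴴ * A := by
  exact Fin.sum_univ_one _

theorem mul_vecMulVec_star_mul {ι κ : Type*} [Fintype ι] (T : Matrix κ ι ℂ) (φ : ι → ℂ) :
    T * Matrix.vecMulVec φ (star φ) * Tᴴ = Matrix.vecMulVec (T *ᵥ φ) (star (T *ᵥ φ)) := by
  rw [Matrix.mul_vecMulVec, Matrix.vecMulVec_mul, Matrix.star_mulVec]

theorem productMap_single {n m : V → ℕ} (A : (v : V) → Matrix (Fin (m v)) (Fin (n v)) ℂ)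
    (φ : Idx n → ℂ) : productMap (fun v => Kraus.single (A v)) (Matrix.vecMulVec φ (star φ)) =
      Matrix.vecMulVec (tensorOp A *ᵥ φ) (star (tensorOp A *ᵥ φ)) := by
  unfold productMap
  have : Unique ((v : V) → Fin (Kraus.single (A v)).rank) := by
    unfold Kraus.single
    infer_instance
  rw [Fintype.sum_unique, mul_vecMulVec_star_mul]
  rfl

theorem tensorOp_submatrix_mulVec {ι κ : V → Type*} [∀ v, Fintype (ι v)]
    (A : (v : V) → Matrix (κ v) (ι v) ℂ) {n m : V → ℕ} (a : (v : V) → Fin (n v) ≃ ι v)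
    (b : (v : V) → Fin (m v) → κ v) (Φ : ((v : V) → ι v) → ℂ) (y : Idx m) :
    (tensorOp (fun v => (A v).submatrix (b v) (a v)) *ᵥ fun x => Φ fun v => a v (x v)) y =
      (localOp A *ᵥ Φ) fun v => b v (y v) := by
  simp only [Matrix.mulVec, dotProduct]
  rw [← (Equiv.piCongrRight a).sum_comp]
  rfl

end Protocols

namespace MultiVec

variable {V : Type u}

/-- The dimension of the system at the node `v`. -/
def dim (P : MultiVec V) (v : V) : ℕ := Fintype.card (P.ι v)

/-- A numbering of the labels. -/
def label (P : MultiVec V) (v : V) : Fin (P.dim v) ≃ P.ι v := (Fintype.equivFin _).symm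

/-- The coefficients with respect to numbered labels. -/
def coords (P : MultiVec V) (x : Idx P.dim) : ℂ := P.vec fun v => P.label v (x v)

/-- The operator `|P⟩⟨P|`. -/
def op (P : MultiVec V) : Op P.dim := Matrix.vecMulVec P.coords (star P.coords)

theorem IsNet.isNetworkState [DecidableEq V] {G : Network V} {P : MultiVec V} (h : IsNet G P) :
    IsNetworkState G P.op := by
  obtain ⟨D, _, φ, g, hg, hP⟩ := h
  let γ : (e : Finset V) → ((v : {v // v ∈ e}) → Fin (Fintype.card (D e v.1))) → ℂ := fun e x =>
    g e fun v => (Fintype.equivFin _).symm (x v)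
  refine ⟨fun e v => Fintype.card (D e v), fun v => (P.label v).trans ((φ v).trans
    (Equiv.piCongrRight fun e => Fintype.equivFin _)),
    fun e => Matrix.vecMulVec (γ e) (star (γ e)), fun e he => ⟨?_, ?_⟩, fun x y => ?_⟩
  · exact Matrix.posSemidef_vecMulVec_self_star _
  · rw [Matrix.trace_vecMulVec, dotProduct]
    have h1 : ∀ x, γ e x * star (γ e) x = ((‖γ e x‖ ^ 2 : ℝ) : ℂ) := fun x => by
      rw [Complex.ofReal_pow]
      exact RCLike.mul_conj (γ e x)
    simp only [h1]
    rw [← Complex.ofReal_sum, ← Complex.ofReal_one, ← hg e he]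
    congr 1
    exact (Equiv.piCongrRight fun v : {v // v ∈ e} =>
      (Fintype.equivFin (D e v.1)).symm).sum_comp fun x => ‖g e x‖ ^ 2
  · have h1 : ∀ x : Idx P.dim, P.coords x = ∏ e : {e // e ∈ G.edges},
        γ e.1 fun v => ((P.label v.1).trans ((φ v.1).trans
          (Equiv.piCongrRight fun e => Fintype.equivFin _))) (x v.1) ⟨e.1, e.2, v.2⟩ := by
      intro x
      rw [coords, hP]
      refine Finset.prod_congr rfl fun e _ => ?_
      simp [γ]
    rw [op, Matrix.vecMulVec_apply, Pi.star_apply, h1, h1, star_prod, ← Finset.prod_mul_distrib]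
    rfl

theorem conjTranspose_mul_submatrix {P Q : MultiVec V} {v : V} (A : Matrix (Q.ι v) (P.ι v) ℂ) :
    (A.submatrix (Q.label v) (P.label v))ᴴ * A.submatrix (Q.label v) (P.label v) =
      (Aᴴ * A).submatrix (P.label v) (P.label v) := by
  rw [Matrix.conjTranspose_submatrix, Matrix.submatrix_mul_equiv]

theorem isChannel_single_submatrix {P Q : MultiVec V} {v : V} {A : Matrix (Q.ι v) (P.ι v) ℂ}
    (hA : IsIsometry A) : (Kraus.single (A.submatrix (Q.label v) (P.label v))).IsChannel := by
  classical
  rw [Kraus.IsChannel, Kraus.gram_single, conjTranspose_mul_submatrix, hA,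
    Matrix.submatrix_one_equiv]

variable [Fintype V] [DecidableEq V] {d : V → ℕ}

/-- `ρ` can be prepared from `P` with `k` rounds of communication. -/
def Reaches (k : ℕ) (P : MultiVec V) (ρ : Op d) : Prop :=
  ∃ Λ, IsLOCC k P.dim d Λ ∧ Λ P.op = ρ

theorem tensorOp_mulVec_coords {P Q : MultiVec V} (A : (v : V) → Matrix (Q.ι v) (P.ι v) ℂ)
    {c : ℂ} (h : localOp A *ᵥ P.vec = c • Q.vec) :
    tensorOp (fun v => (A v).submatrix (Q.label v) (P.label v)) *ᵥ P.coords = c • Q.coords := by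
  funext y
  exact (tensorOp_submatrix_mulVec A P.label (fun v => Q.label v) P.vec y).trans (by rw [h]; rfl)

theorem LocalIso.reaches {k : ℕ} {P Q : MultiVec V} {ρ : Op d} (h : LocalIso P Q)
    (hQ : Reaches k Q ρ) : Reaches k P ρ := by
  obtain ⟨A, hA, hPQ⟩ := h
  obtain ⟨Λ, hΛ, hQ⟩ := hQ
  refine ⟨_, hΛ.comp_productMap (fun v => Kraus.single ((A v).submatrix (Q.label v) (P.label v)))
    fun v => isChannel_single_submatrix (hA v), ?_⟩
  rw [op, productMap_single, tensorOp_mulVec_coords A (c := 1) (by rw [hPQ, one_smul]), one_smul]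
  exact hQ

/-- Outcome `i` leaves `‖c i‖ ^ 2` times the projector of `Q`, so the same continuation works for
all outcomes, and the weights sum to one. -/
theorem Step.reaches {k : ℕ} {s : V} {P Q : MultiVec V} {ρ : Op d} (h : Step s P Q)
    (hQ : Reaches k Q ρ) : Reaches (k + 1) P ρ := by
  classical
  obtain ⟨I, _, A, c, h1, h2, h3, h4⟩ := h
  obtain ⟨Λ, hΛ, hQ⟩ := hQ
  let e := (Fintype.equivFin I).symm
  refine ⟨_, .round s (Fintype.card I) (fun _ => Q.dim)
    (fun i v => Kraus.single ((A (e i) v).submatrix (Q.label v) (P.label v))) ?_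
    (fun i v hv => isChannel_single_submatrix (h2 _ v hv)) (fun _ => Λ) (fun _ => hΛ), ?_⟩
  · simp only [Kraus.gram_single, conjTranspose_mul_submatrix]
    rw [e.sum_comp fun i => ((A i s)ᴴ * A i s).submatrix (P.label s) (P.label s)]
    ext x y
    have := congrFun (congrFun h1 (P.label s x)) (P.label s y)
    rw [Matrix.sum_apply] at this ⊢
    simp only [Matrix.submatrix_apply]
    rw [this]
    simp [Matrix.one_apply]
  · have h5 : ∀ i, Λ (productMap (fun v => Kraus.single
        ((A (e i) v).submatrix (Q.label v) (P.label v))) P.op) = (‖c (e i)‖ ^ 2) • ρ := by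
      intro i
      rw [op, productMap_single, tensorOp_mulVec_coords _ (h3 (e i)), ← hQ, ← hΛ.map_smul]
      congr 1
      ext x y
      simp only [op, Matrix.vecMulVec_apply, Pi.smul_apply, Pi.star_apply, smul_eq_mul, star_mul',
        Matrix.smul_apply, Complex.real_smul]
      rw [Complex.ofReal_pow, ← Complex.mul_conj']
      simp only [Complex.star_def]
      ring
    simp only [h5]
    rw [← Finset.sum_smul, e.sum_comp fun i => ‖c i‖ ^ 2, h4, one_smul]

/-- `Chain` appends rounds at the end, whereas `IsLOCC` prepends them; hence the induction is over
all continuations, with `j` general. -/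
theorem Chain.reaches {k : ℕ} {P Q : MultiVec V} {ρ : Op d} (h : Chain k P Q) {j : ℕ}
    (hQ : Reaches j Q ρ) : Reaches (k + j) P ρ := by
  induction h generalizing j with
  | iso h => rw [Nat.zero_add]; exact h.reaches hQ
  | step _ s h' ih =>
    rw [Nat.add_assoc, Nat.add_comm 1]
    exact ih (h'.reaches hQ)

/-- If the system `w` of `ψ` is at the node `w`, for all `w`, then all that remains to be done is
to discard the other registers. -/
theorem reaches_located_id [∀ v, NeZero (d v)] (ψ : Idx d → ℂ) (κ : V → Type u)
    [∀ v, Fintype (κ v)] (g : (v : V) → κ v) :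
    Reaches 0 ((located ψ id).tensor (basis κ g)) (Matrix.vecMulVec ψ (star ψ)) := by
  classical
  set P := (located ψ id).tensor (basis κ g)
  let f : (v : V) → Idx d × κ v → Fin (d v) := fun v x => x.1 v
  -- `f` is the system to keep and `h` the content to discard. Together they determine the label, so
  -- the Kraus operators that select a value of `h` and output `f` form a channel.
  let h : (v : V) → Idx d × κ v → Idx d × κ v := fun v x => (Function.update x.1 v 0, x.2)
  have hfh : ∀ v x y, f v x = f v y → h v x = h v y → x = y := by
    rintro v ⟨x, t⟩ ⟨y, t'⟩ h1 h2
    obtain ⟨h3, h4⟩ := Prod.mk.inj h2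
    refine Prod.ext ?_ h4
    funext w
    by_cases hw : w = v
    · subst hw
      exact h1
    · simpa [hw] using congrFun h3 w
  let label : (v : V) → Fin (P.dim v) ≃ Idx d × κ v := P.label
  let a : (v : V) → Fin (P.dim v) → Idx d × κ v → ℂ := fun v j x =>
    if h v x = label v j then 1 else 0
  let K : (v : V) → Kraus (P.dim v) (d v) := fun v =>
    ⟨P.dim v, fun j => (monoOp (f v) (a v j)).submatrix (fun i => i) (label v)⟩
  have hK : ∀ v, (K v).IsChannel := by
    intro v
    ext x y
    simp only [Kraus.gram, K, Matrix.conjTranspose_submatrix, Matrix.sum_apply]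
    have h1 : ∀ j, ((monoOp (f v) (a v j))ᴴ.submatrix (label v) (fun i => i) *
        (monoOp (f v) (a v j)).submatrix (fun i => i) (label v)) x y =
        if f v (label v x) = f v (label v y) then
          star (a v j (label v x)) * a v j (label v y) else 0 := fun j =>
      monoOp_conjTranspose_mul_monoOp (f v) (a v j) (label v x) (label v y)
    simp only [h1]
    by_cases hxy : x = y
    · subst hxy
      simp only [if_true, Matrix.one_apply_eq, a]
      rw [Finset.sum_eq_single ((label v).symm (h v (label v x)))]
      · simp
      · intro j _ hj
        rw [if_neg]
        · simp
        · intro h2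
          exact hj (by rw [h2, Equiv.symm_apply_apply])
      · simp
    · rw [Matrix.one_apply_ne hxy]
      refine Finset.sum_eq_zero fun j _ => ?_
      split_ifs with h2
      · simp only [a]
        split_ifs with h3 h4
        · exact absurd ((label v).injective (hfh v _ _ h2 (h3.trans h4.symm))) hxy
        all_goals simp
      · rfl
  refine ⟨_, .localOps K hK, ?_⟩
  -- The discarded content is the same in all terms of the superposition, so only this Kraus index
  -- contributes and coherence is kept.
  let j₀ : (v : V) → Fin (P.dim v) := fun v => (label v).symm (0, g v)
  have hT : ∀ j : (v : V) → Fin (P.dim v), tensorOp (fun v => (K v).op (j v)) *ᵥ P.coords =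
      if j = j₀ then ψ else 0 := by
    intro j
    have h1 : localOp (fun v => monoOp (f v) (a v (j v))) *ᵥ P.vec =
        ketSum (fun z => (∏ v, a v (j v) (place id z v, g v)) * ψ z)
          fun z v => f v (place id z v, g v) := by
      rw [← localOp_monoOp_mulVec_ketSum]
      congr 1
      exact funext fun x => super_tensor_basis_vec ψ (place id) g x
    have h2 : ∀ z v, a v (j v) (place id z v, g v) = if j v = j₀ v then 1 else 0 := by
      intro z v
      have : h v (place id z v, g v) = (0, g v) := by
        refine Prod.ext ?_ rfl
        funext w
        by_cases hw : w = v
        · subst hw; simp [h]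
        · simp [h, hw, place]
      simp only [a, this, j₀, Equiv.eq_symm_apply, eq_comm]
    have h3 : ∀ z v, f v (place id z v, g v) = z v := by
      intro z v
      simp [f, place]
    simp only [h2, h3] at h1
    funext y
    refine (tensorOp_submatrix_mulVec (fun v => monoOp (f v) (a v (j v))) label
      (fun v i => i) P.vec y).trans ?_
    rw [h1]
    unfold ketSum
    rw [Finset.sum_eq_single y]
    · rw [if_pos rfl]
      by_cases hj : j = j₀
      · simp [hj]
      · obtain ⟨v, hv⟩ := Function.ne_iff.1 hj
        rw [if_neg hj, Finset.prod_eq_zero (Finset.mem_univ v) (if_neg hv)]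
        exact zero_mul _
    · exact fun z _ hz => if_neg fun h => hz h.symm
    · simp
  change ∑ j : (v : V) → Fin (P.dim v), _ = _
  rw [Finset.sum_eq_single j₀]
  · rw [op, mul_vecMulVec_star_mul, hT, if_pos rfl]
  · intro j _ hj
    rw [op, mul_vecMulVec_star_mul, hT, if_neg hj]
    ext
    simp [Matrix.vecMulVec_apply]
  · simp

theorem mem_preparable {G : Network V} {ψ : Idx d → ℂ} (hψ : star ψ ⬝ᵥ ψ = 1) {S : Finset V}
    (hS : G.IsConnectedDominating S) :
    Matrix.vecMulVec ψ (star ψ) ∈ preparable G d S.card := by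
  -- A unit vector exists only if all local dimensions are nonzero, which provides the zero labels
  -- of idle registers.
  have hd : Nonempty (Idx d) := by
    by_contra h
    rw [not_nonempty_iff] at h
    simp at hψ
  have : ∀ v, NeZero (d v) := fun v => ⟨fun h => (h ▸ hd.some v : Fin 0).elim0⟩
  obtain ⟨R, κ, _, g, hR, hchain⟩ := covers_univ hψ hS id fun _ => Set.mem_univ _
  obtain ⟨Λ, hΛ, hρ⟩ := hchain.reaches (reaches_located_id ψ κ g)
  exact ⟨R.dim, R.op, 1, fun _ => 1, fun _ => Λ, hR.isNetworkState, by simp, fun _ => hΛ,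
    by simp [hρ]⟩

end MultiVec

end QNet

end

/-! ### The theorem -/

theorem mainTheorem3 {V : Type*} [Fintype V] [DecidableEq V] (G : QNet.Network V)
    (hG : ¬ G.IsComplete) (d : V → ℕ) (ρ : QNet.Op d) (hρ : QNet.IsPureState ρ)
    (hent : ∀ u v : V, u ≠ v → ¬ G.graph.Adj u v → ¬ QNet.IsSeparable (QNet.reducedPair ρ u v)) :
    QNet.networkRoundComplexity G ρ = (G.connectedDominationNumber : ENNReal) := by
  rw [QNet.networkRoundComplexity_of_isPureState G hρ]
  obtain ⟨ψ, hψ, rfl⟩ := hρ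
  congr 1
  apply le_antisymm
  · exact le_iInf fun S => le_iInf fun hS => by
      unfold QNet.minRounds
      exact (iInf_le _ S.card).trans
        (iInf_le _ (subset_closure (QNet.MultiVec.mem_preparable hψ hS)))
  · refine le_iInf fun k => le_iInf fun hk => ?_
    obtain ⟨S, hS, hdom⟩ := QNet.exists_isConnectedDominating_of_mem_closure hG hψ hent hk
    exact (iInf₂_le S hdom).trans (Nat.cast_le.2 hS)
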